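/- Let $F$ be a real quadratic field with ring of integers $\mathcal{O}_F$, and let $x\mapsto x$ and $x\mapsto x'$ denote its two embeddings into $\mathbb{R}$. Let $\mathbb{H}=\{\tau\in\mathbb{C} : \operatorname{Im}\tau>0\}$, and let $\mathrm{SL}_2(F)$ act on $\mathbb{H}^2$ by $$\begin{pmatrix} a&b\\ c&d\end{pmatrix}(z_1,z_2)=\left(\frac{az_1+b}{cz_1+d},\ \frac{a'z_2+b'}{c'z_2+d'}\right).$$ Let $\Gamma\subset \mathrm{SL}_2(F)$ be a subgroup commensurable with $\mathrm{SL}_2(\mathcal{O}_F)$, i.e. $\Gamma\cap \mathrm{SL}_2(\mathcal{O}_F)$ has finite index both in $\Gamma$ and in $\mathrm{SL}_2(\mathcal{O}_F)$, and let $k\in\mathbb{Z}$. Let $M_k(\Gamma)$ be the complex vector space of holomorphic Hilbert modular forms of (parallel) weight $k$ for $\Gamma$, that is, of holomorphic functions $f:\mathbb{H}^2\to\mathbb{C}$ with $$f(\gamma z)=(cz_1+d)^{k}(c'z_2+d')^{k}f(z)\qquad\text{for all } \gamma=\begin{pmatrix} a&b\\ c&d\end{pmatrix}\in\Gamma,\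 z=(z_1,z_2)\in\mathbb{H}^2.$$ Then $M_k(\Gamma)$ is a finite dimensional complex vector space. -/

import Mathlib

open scoped MatrixGroups

namespace HilbertModular

/-- The Hilbert modular group `SL₂(𝓞_F)`, as a subgroup of `SL₂(F)`. -/
def fullGroup (F : Type*) [Field F] [NumberField F] : Subgroup SL(2, F) :=
  (Matrix.SpecialLinearGroup.map (n := Fin 2)
    (algebraMap (NumberField.RingOfIntegers F) F)).range

/-- The action of `γ ∈ SL₂(F)` on `ℍ × ℍ` by fractional linear transformations, through the real
embedding `σ₁` on the first factor and `σ₂` on the second one. -/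
noncomputable def act {F : Type*} [Field F] (σ₁ σ₂ : F →+* ℝ) (γ : SL(2, F))
    (z : UpperHalfPlane × UpperHalfPlane) : UpperHalfPlane × UpperHalfPlane :=
  (Matrix.SpecialLinearGroup.map σ₁ γ • z.1, Matrix.SpecialLinearGroup.map σ₂ γ • z.2)

/-- The factor `(c z₁ + d)^k₁ (c' z₂ + d')^k₂` for `γ = (a b; c d) ∈ SL₂(F)`. -/
noncomputable def factor {F : Type*} [Field F] (σ₁ σ₂ : F →+* ℝ) (k₁ k₂ : ℤ) (γ : SL(2, F))
    (z : UpperHalfPlane × UpperHalfPlane) : ℂ :=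
  ((σ₁ (γ 1 0) : ℂ) * (z.1 : ℂ) + (σ₁ (γ 1 1) : ℂ)) ^ k₁ *
    ((σ₂ (γ 1 0) : ℂ) * (z.2 : ℂ) + (σ₂ (γ 1 1) : ℂ)) ^ k₂

/-- A function on `ℍ × ℍ` is holomorphic if it is complex differentiable as a function of two
complex variables on the open subset `{Im z₁ > 0, Im z₂ > 0}` of `ℂ × ℂ`
(`UpperHalfPlane.ofComplex` is the inverse of the inclusion of `ℍ` in `ℂ` there). -/
def IsHolomorphic (f : UpperHalfPlane × UpperHalfPlane → ℂ) : Prop :=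
  DifferentiableOn ℂ
    (fun w : ℂ × ℂ => f (UpperHalfPlane.ofComplex w.1, UpperHalfPlane.ofComplex w.2))
    {w : ℂ × ℂ | 0 < w.1.im ∧ 0 < w.2.im}

/-- The complex vector space of holomorphic Hilbert modular forms of weight `(k₁, k₂)` for `Γ`. -/
def modularForms {F : Type*} [Field F] (σ₁ σ₂ : F →+* ℝ) (k₁ k₂ : ℤ) (Γ : Subgroup SL(2, F)) :
    Submodule ℂ (UpperHalfPlane × UpperHalfPlane → ℂ) where
  carrier := {f | IsHolomorphic f ∧
    ∀ γ ∈ Γ, ∀ z, f (act σ₁ σ₂ γ z) = factor σ₁ σ₂ k₁ k₂ γ z * f z}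
  add_mem' := by
    rintro f g ⟨hf, hf'⟩ ⟨hg, hg'⟩
    refine ⟨DifferentiableOn.add hf hg, fun γ hγ z => ?_⟩
    simp only [Pi.add_apply, hf' γ hγ z, hg' γ hγ z, mul_add]
  zero_mem' := ⟨differentiableOn_const 0, fun γ _ z => by simp⟩
  smul_mem' := by
    rintro c f ⟨hf, hf'⟩
    refine ⟨DifferentiableOn.const_smul hf c, fun γ hγ z => ?_⟩
    simp only [Pi.smul_apply, hf' γ hγ z, smul_eq_mul, mul_left_comm]

end HilbertModular

/-! ### Finite dimensionality from bounds on compact sets -/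

namespace HilbertModular

open Complex Metric Set Filter Topology UpperHalfPlane

/-! The space is finite dimensional because its members are controlled, on every compact set and
with uniform constants, by their size on one fixed compact set `K`. Given such control,
`finiteDimensional_of_forall_isCompact_bound` shows by the Schwarz lemma that a form vanishing on a
fine enough finite net in `K` is zero, so evaluation on the net is injective.

The control has an analytic and an arithmetic source. The analytic one is a quantitative Koecher
principle, which is why no condition at the cusps is needed. At a cusp, `|f|` is invariant under a
lattice of translations and under a scaling by `(e, e⁻¹)` coming from a unit, so the hypersurface
`Im z₁ Im z₂ = c` is compact modulo these symmetries. Each point above it lies on a complex line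
that meets `Im z₁ Im z₂ ≥ c` in a strip with edges on the hypersurface; by Phragmén–Lindelöf the
bound on the hypersurface spreads to the whole region (`exists_isCompact_bound_of_periodic`,
`exists_isCompact_slash_bound`).

The arithmetic one is reduction theory: Minkowski's theorem and the finiteness of the class group
show that `Γ`, followed by finitely many elements of `SL₂(F)`, carries every point into such a
region (`exists_finite_reduction`). On a compact set the automorphy factors that arise are bounded
above and away from zero, although infinitely many group elements may occur
(`exists_norm_factor_inv_le`). This settles all weights `k` at once. -/

/-- The product of two upper half planes, as an open subset of `ℂ × ℂ`. -/
def upperDomain : Set (ℂ × ℂ) := {w | 0 < w.1.im ∧ 0 < w.2.im}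

lemma isOpen_upperDomain : IsOpen upperDomain :=
  (isOpen_lt continuous_const (Complex.continuous_im.comp continuous_fst)).inter
    (isOpen_lt continuous_const (Complex.continuous_im.comp continuous_snd))

/-- The inclusion of `ℍ × ℍ` in `ℂ × ℂ`. -/
def coePair (z : ℍ × ℍ) : ℂ × ℂ := (z.1, z.2)

lemma isEmbedding_coePair : IsEmbedding coePair :=
  isEmbedding_coe.prodMap isEmbedding_coe

lemma coePair_mem (z : ℍ × ℍ) : coePair z ∈ upperDomain := ⟨z.1.im_pos, z.2.im_pos⟩

lemma range_coePair : range coePair = upperDomain := by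
  ext w
  constructor
  · rintro ⟨z, rfl⟩
    exact coePair_mem z
  · exact fun hw => ⟨(⟨w.1, hw.1⟩, ⟨w.2, hw.2⟩), rfl⟩

/-- A function on `ℍ × ℍ`, extended to `ℂ × ℂ`. -/
noncomputable def extendPair (f : ℍ × ℍ → ℂ) (w : ℂ × ℂ) : ℂ :=
  f (ofComplex w.1, ofComplex w.2)

lemma extendPair_coePair (f : ℍ × ℍ → ℂ) (z : ℍ × ℍ) : extendPair f (coePair z) = f z := by
  simp [extendPair, coePair, ofComplex_apply]

lemma isCompact_preimage_coePair {Q : Set (ℂ × ℂ)} (hQ : IsCompact Q) (h : Q ⊆ upperDomain) :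
    IsCompact (coePair ⁻¹' Q) :=
  isEmbedding_coePair.isInducing.isCompact_preimage_iff (range_coePair ▸ h) |>.2 hQ

/-- A space of holomorphic functions on `ℍ × ℍ` is finite dimensional if the size of its members
on every compact set is controlled by their size on a fixed compact set. -/
theorem finiteDimensional_of_forall_isCompact_bound (V : Submodule ℂ (ℍ × ℍ → ℂ))
    (hV : ∀ f ∈ V, IsHolomorphic f) {K : Set (ℍ × ℍ)} (hK : IsCompact K)
    (h : ∀ Q : Set (ℍ × ℍ), IsCompact Q → ∃ C : ℝ, ∀ f ∈ V, ∀ B : ℝ, 0 ≤ B →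
      (∀ w ∈ K, ‖f w‖ ≤ B) → ∀ z ∈ Q, ‖f z‖ ≤ C * B) :
    FiniteDimensional ℂ V := by
  have hK' : IsCompact (coePair '' K) := hK.image isEmbedding_coePair.continuous
  have hKU : coePair '' K ⊆ upperDomain := by
    rintro _ ⟨z, -, rfl⟩
    exact coePair_mem z
  obtain ⟨r, hr, hrU⟩ := hK'.exists_cthickening_subset_open isOpen_upperDomain hKU
  obtain ⟨C, hC⟩ := h _ (isCompact_preimage_coePair (hK'.cthickening (r := r)) hrU)
  -- The mesh is fine enough for the Schwarz lemma on balls of radius `r` to gain a factor `1/4`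
  -- over the loss `|C| + 1`.
  set δ : ℝ := r / (4 * (|C| + 1)) with hδ
  have hδ0 : 0 < δ := by positivity
  have hδr : δ < r := by
    rw [hδ, div_lt_iff₀ (by positivity)]
    nlinarith [abs_nonneg C, mul_nonneg hr.le (abs_nonneg C)]
  obtain ⟨S, hSK, hSfin, hS⟩ := hK'.finite_cover_balls hδ0
  have := hSfin.to_subtype
  let T : V →ₗ[ℂ] (S → ℂ) :=
    { toFun := fun f p => extendPair f.1 p.1
      map_add' := fun f g => rfl
      map_smul' := fun c f => rfl }
  refine FiniteDimensional.of_injective T ?_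
  rw [← LinearMap.ker_eq_bot, LinearMap.ker_eq_bot']
  rintro ⟨f, hf⟩ hTf
  -- Vanishing on `K` propagates to every point by the hypothesis with `B = 0`, so no identity
  -- theorem is needed.
  suffices hfK : ∀ w ∈ K, ‖f w‖ ≤ 0 by
    ext z
    obtain ⟨C', hC'⟩ := h {z} isCompact_singleton
    simpa using hC' f hf 0 le_rfl hfK z rfl
  rcases K.eq_empty_or_nonempty with rfl | hne
  · simp
  have hhol : DifferentiableOn ℂ (extendPair f) upperDomain := hV f hf
  have hcont : ContinuousOn (fun z => ‖f z‖) K := by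
    have : Continuous (fun z => extendPair f (coePair z)) :=
      hhol.continuousOn.comp_continuous isEmbedding_coePair.continuous coePair_mem
    simpa only [extendPair_coePair] using this.norm.continuousOn
  obtain ⟨p, hpK, hp⟩ := hK.exists_isMaxOn hne hcont
  suffices ‖f p‖ ≤ 0 from fun w hw => (hp hw).trans this
  obtain ⟨q, hqS, hq⟩ := mem_iUnion₂.1 (hS ⟨p, hpK, rfl⟩)
  have hfq : extendPair f q = 0 := congrFun hTf ⟨q, hqS⟩
  have hball : ball q r ⊆ cthickening r (coePair '' K) :=
    (ball_subset_thickening (hSK hqS) r).trans (thickening_subset_cthickening _ _)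
  by_contra! hpos
  have hbd : ∀ w ∈ ball q r, ‖extendPair f w‖ < (|C| + 1) * ‖f p‖ := by
    intro w hw
    have hwU := hrU (hball hw)
    rw [← range_coePair] at hwU
    obtain ⟨z, rfl⟩ := hwU
    rw [extendPair_coePair]
    have := hC f hf _ (norm_nonneg _) hp z (hball hw)
    nlinarith [le_abs_self C]
  -- Schwarz lemma about the zero `q`, evaluated at the maximum point `p`: it yields `‖f p‖ ≤ ‖f p‖
  -- / 4`.
  have := Complex.dist_le_div_mul_dist_of_mapsTo_ball (R₂ := (|C| + 1) * ‖f p‖)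
    (hhol.mono (hball.trans hrU))
    (fun w hw => by simpa [hfq, dist_eq_norm] using (hbd w hw).le)
    (mem_ball.2 ((mem_ball.1 hq).trans hδr))
  rw [hfq, dist_zero_right, extendPair_coePair] at this
  have h2 : (|C| + 1) * ‖f p‖ / r * dist (coePair p) q ≤ (|C| + 1) * ‖f p‖ / r * δ := by
    gcongr
    exact (mem_ball.1 hq).le
  have h3 : (|C| + 1) * ‖f p‖ / r * δ = ‖f p‖ / 4 := by
    rw [hδ]; field_simp
  linarith

/-! ### The Koecher principle for periodic functions -/

/-- The point `s v₁ + t v₂ + i (y₁, y₂)` of `ℂ × ℂ`. -/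
noncomputable def tubePoint (v₁ v₂ : ℝ × ℝ) (p : (ℝ × ℝ) × (ℝ × ℝ)) : ℂ × ℂ :=
  (((p.1.1 * v₁.1 + p.1.2 * v₂.1 : ℝ) : ℂ) + p.2.1 * Complex.I,
    ((p.1.1 * v₁.2 + p.1.2 * v₂.2 : ℝ) : ℂ) + p.2.2 * Complex.I)

lemma continuous_tubePoint (v₁ v₂ : ℝ × ℝ) : Continuous (tubePoint v₁ v₂) := by
  unfold tubePoint; fun_prop

lemma apply_add_int_mul {X : Type*} {G : ℂ × ℂ → X} {v : ℝ × ℝ}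
    (hG : ∀ w ∈ upperDomain, G (w.1 + v.1, w.2 + v.2) = G w) (n : ℤ) :
    ∀ w ∈ upperDomain, G (w.1 + ((n * v.1 : ℝ) : ℂ), w.2 + ((n * v.2 : ℝ) : ℂ)) = G w := by
  induction n with
  | zero => simp
  | succ n ih =>
    intro w hw
    rw [← ih w hw, ← hG (w.1 + (((n : ℤ) * v.1 : ℝ) : ℂ), w.2 + (((n : ℤ) * v.2 : ℝ) : ℂ))
      (by simpa [upperDomain] using hw)]
    congr 2 <;> push_cast <;> ring
  | pred n ih =>
    intro w hw
    rw [← ih w hw, ← hG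
      (w.1 + (((-n - 1 : ℤ) * v.1 : ℝ) : ℂ), w.2 + (((-n - 1 : ℤ) * v.2 : ℝ) : ℂ))
      (by simpa [upperDomain] using hw)]
    congr 2 <;> push_cast <;> ring

/-- Reduction of the real part modulo the lattice spanned by two periods. -/
lemma exists_apply_tubePoint_eq {X : Type*} {G : ℂ × ℂ → X} {v₁ v₂ : ℝ × ℝ}
    (hv : v₁.1 * v₂.2 - v₁.2 * v₂.1 ≠ 0)
    (h₁ : ∀ w ∈ upperDomain, G (w.1 + v₁.1, w.2 + v₁.2) = G w)
    (h₂ : ∀ w ∈ upperDomain, G (w.1 + v₂.1, w.2 + v₂.2) = G w)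
    {w : ℂ × ℂ} (hw : w ∈ upperDomain) :
    ∃ p : ℝ × ℝ, p ∈ Icc (0 : ℝ) 1 ×ˢ Icc (0 : ℝ) 1 ∧
      G (tubePoint v₁ v₂ (p, (w.1.im, w.2.im))) = G w := by
  set Δ := v₁.1 * v₂.2 - v₁.2 * v₂.1 with hΔ
  set s := (w.1.re * v₂.2 - w.2.re * v₂.1) / Δ with hs
  set t := (v₁.1 * w.2.re - v₁.2 * w.1.re) / Δ with ht
  refine ⟨(Int.fract s, Int.fract t), ⟨⟨Int.fract_nonneg _, (Int.fract_lt_one _).le⟩,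
    ⟨Int.fract_nonneg _, (Int.fract_lt_one _).le⟩⟩, ?_⟩
  set w' := tubePoint v₁ v₂ ((Int.fract s, Int.fract t), (w.1.im, w.2.im)) with hw'
  have hmem : w' ∈ upperDomain := by simpa [hw', tubePoint, upperDomain] using hw
  rw [← apply_add_int_mul h₁ ⌊s⌋ w' hmem, ← apply_add_int_mul h₂ ⌊t⌋ _
    (by simpa [upperDomain] using hmem)]
  have e₁ : s * v₁.1 + t * v₂.1 = w.1.re := by
    rw [hs, ht]; field_simp; rw [hΔ]; ring
  have e₂ : s * v₁.2 + t * v₂.2 = w.2.re := by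
    rw [hs, ht]; field_simp; rw [hΔ]; ring
  congr 1
  refine Prod.ext (Complex.ext ?_ ?_) (Complex.ext ?_ ?_)
  · simp only [hw', tubePoint, ← Int.self_sub_floor]; simp [-Int.self_sub_floor]; linarith
  · simp [hw', tubePoint]
  · simp only [hw', tubePoint, ← Int.self_sub_floor]; simp [-Int.self_sub_floor]; linarith
  · simp [hw', tubePoint]

/-- A holomorphic function with two independent real periods, whose absolute value is invariant
under `(w₁, w₂) ↦ (e w₁, e⁻¹ w₂)`, is bounded on the region `Im w₁ Im w₂ ≥ c` by its size on a
compact set. -/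
theorem exists_isCompact_bound_of_periodic {v₁ v₂ : ℝ × ℝ} (hv : v₁.1 * v₂.2 - v₁.2 * v₂.1 ≠ 0)
    {e : ℝ} (he0 : 0 < e) (he1 : e < 1) {c : ℝ} (hc : 0 < c) :
    ∃ K ⊆ upperDomain, IsCompact K ∧ ∀ G : ℂ × ℂ → ℂ, DifferentiableOn ℂ G upperDomain →
      (∀ w ∈ upperDomain, G (w.1 + v₁.1, w.2 + v₁.2) = G w) →
      (∀ w ∈ upperDomain, G (w.1 + v₂.1, w.2 + v₂.2) = G w) →
      (∀ w ∈ upperDomain, ‖G (e * w.1, (e⁻¹ : ℝ) * w.2)‖ = ‖G w‖) →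
      ∀ B : ℝ, (∀ w ∈ K, ‖G w‖ ≤ B) →
      ∀ w ∈ upperDomain, c ≤ w.1.im * w.2.im → ‖G w‖ ≤ B := by
  -- Real parts run over a period parallelogram. Scaling by powers of `e` brings `Im w₁` into `[e,
  -- 1]`, and then `Im w₂ = c / Im w₁` lies in `[c, c / e]`.
  have hcpt : IsCompact ((Icc (0 : ℝ) 1 ×ˢ Icc (0 : ℝ) 1) ×ˢ (Icc e 1 ×ˢ Icc c (c / e))) :=
    (isCompact_Icc.prod isCompact_Icc).prod (isCompact_Icc.prod isCompact_Icc)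
  refine ⟨_, ?_, hcpt.image (continuous_tubePoint v₁ v₂), ?_⟩
  · rintro _ ⟨⟨p, y⟩, ⟨-, hy₁, hy₂⟩, rfl⟩
    simp only [mem_Icc] at hy₁ hy₂
    constructor <;> simp [tubePoint] <;> linarith
  intro G hG h₁ h₂ he B hB
  have hscale : ∀ n : ℤ, ∀ w ∈ upperDomain,
      ((e ^ n : ℝ) * w.1, ((e ^ n)⁻¹ : ℝ) * w.2) ∈ upperDomain ∧
      ‖G ((e ^ n : ℝ) * w.1, ((e ^ n)⁻¹ : ℝ) * w.2)‖ = ‖G w‖ := by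
    have hmem (n : ℤ) (w : ℂ × ℂ) (hw : w ∈ upperDomain) :
        ((e ^ n : ℝ) * w.1, ((e ^ n)⁻¹ : ℝ) * w.2) ∈ upperDomain := by
      constructor
      · rw [Complex.im_ofReal_mul]; exact mul_pos (zpow_pos he0 n) hw.1
      · rw [Complex.im_ofReal_mul]; exact mul_pos (inv_pos.2 (zpow_pos he0 n)) hw.2
    intro n w hw
    refine ⟨hmem n w hw, ?_⟩
    have he0' : (e : ℂ) ≠ 0 := by exact_mod_cast he0.ne'
    induction n with
    | zero => simp
    | succ n ih =>
      rw [← ih, ← he _ (hmem n w hw)]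
      congr 3
      · push_cast [zpow_add_one₀ he0']; ring
      · push_cast [zpow_add₀ he0']; field_simp
    | pred n ih =>
      rw [← ih, ← he _ (hmem (-n - 1) w hw)]
      congr 3
      · push_cast [zpow_sub₀ he0']; field_simp
      · push_cast [zpow_sub₀ he0']; field_simp
  have hlevel : ∀ w ∈ upperDomain, w.1.im * w.2.im = c → ‖G w‖ ≤ B := by
    intro w hw hwc
    -- Here `e⁻ⁿ < Im w₁ ≤ e⁻⁽ⁿ⁺¹⁾`, so the scaling that lands in `(e, 1]` is by `e ^ (n + 1)`.
    obtain ⟨n, hn₁, hn₂⟩ := exists_mem_Ioc_zpow hw.1 ((one_lt_inv₀ he0).2 he1)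
    rw [inv_zpow] at hn₁ hn₂
    obtain ⟨hm, hn⟩ := hscale (n + 1) w hw
    set w' : ℂ × ℂ := ((e ^ (n + 1) : ℝ) * w.1, ((e ^ (n + 1))⁻¹ : ℝ) * w.2) with hw'
    have hpos : 0 < e ^ n := zpow_pos he0 n
    have i₁ : w'.1.im = e ^ (n + 1) * w.1.im := Complex.im_ofReal_mul _ _
    have i₂ : w'.2.im = (e ^ (n + 1))⁻¹ * w.2.im := Complex.im_ofReal_mul _ _
    have hprod : w'.1.im * w'.2.im = c := by
      rw [i₁, i₂, ← hwc]; field_simp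
    have b₁ : w'.1.im ≤ 1 := by
      rw [i₁]
      exact (le_inv_mul_iff₀ (zpow_pos he0 _)).1 (by simpa using hn₂)
    have b₂ : e ≤ w'.1.im := by
      rw [i₁, zpow_add_one₀ he0.ne']
      have : 1 < e ^ n * w.1.im := (inv_mul_lt_iff₀ hpos).1 (by simpa using hn₁)
      nlinarith
    obtain ⟨p, hp, hGp⟩ := exists_apply_tubePoint_eq hv h₁ h₂ hm
    rw [← hn, ← hGp]
    refine hB _ ⟨_, ⟨hp, ⟨b₂, b₁⟩, ?_, ?_⟩, rfl⟩
    · have := hm.2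
      nlinarith
    · rw [le_div_iff₀ he0]
      have := hm.2
      nlinarith
  intro w hw hwc
  have hy := mul_pos hw.1 hw.2
  set s := √(1 - c / (w.1.im * w.2.im)) with hs
  have hq : c / (w.1.im * w.2.im) ≤ 1 := (div_le_one hy).2 hwc
  have hs2 : s ^ 2 = 1 - c / (w.1.im * w.2.im) := Real.sq_sqrt (by linarith)
  have hcy : w.1.im * w.2.im * (c / (w.1.im * w.2.im)) = c := mul_div_cancel₀ c hy.ne'
  have hs0 : 0 ≤ s := Real.sqrt_nonneg _
  have hs1 : s < 1 := by
    have : 0 < c / (w.1.im * w.2.im) := by positivity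
    nlinarith
  -- If `s = 0` the strip degenerates, but then `w` is already on the level set.
  rcases hs0.eq_or_lt with hs0 | hs0
  · refine hlevel w hw ?_
    rw [← hs0] at hs2
    nlinarith
  -- Along this complex line the product of imaginary parts is `Im w₁ Im w₂ (1 - (Im t)²)`; `s` is
  -- chosen so that it equals `c` exactly when `|Im t| = s`.
  let L : ℂ → ℂ × ℂ := fun t => (w.1 + t * (w.1.im : ℝ), w.2 - t * (w.2.im : ℝ))
  have hLi₁ (t : ℂ) : (L t).1.im = w.1.im * (1 + t.im) := by simp [L]; ring
  have hLi₂ (t : ℂ) : (L t).2.im = w.2.im * (1 - t.im) := by simp [L]; ring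
  have hL : ∀ t : ℂ, |t.im| < 1 → L t ∈ upperDomain := by
    intro t ht
    rw [abs_lt] at ht
    refine ⟨?_, ?_⟩
    · rw [hLi₁]; exact mul_pos hw.1 (by linarith)
    · rw [hLi₂]; exact mul_pos hw.2 (by linarith)
  have hLd : Differentiable ℂ L := by fun_prop
  have hedge : ∀ t : ℂ, t.im ^ 2 = s ^ 2 → ‖G (L t)‖ ≤ B := by
    intro t ht
    refine hlevel _ (hL t ?_) ?_
    · rw [sq_eq_sq_iff_abs_eq_abs, abs_of_pos hs0] at ht
      rwa [ht]
    · rw [hLi₁, hLi₂]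
      have : w.1.im * (1 + t.im) * (w.2.im * (1 - t.im)) = w.1.im * w.2.im * (1 - t.im ^ 2) := by
        ring
      rw [this, ht, hs2, sub_sub_cancel, hcy]
  -- The strip is unbounded only in the real direction, where the periods reduce its image to a
  -- compact set.
  have hbdd : ∃ D, ∀ t : ℂ, |t.im| ≤ s → ‖G (L t)‖ ≤ D := by
    have hcpt' : IsCompact (tubePoint v₁ v₂ '' ((Icc (0 : ℝ) 1 ×ˢ Icc (0 : ℝ) 1) ×ˢ
        (Icc (w.1.im * (1 - s)) (w.1.im * (1 + s)) ×ˢ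
          Icc (w.2.im * (1 - s)) (w.2.im * (1 + s))))) :=
      ((isCompact_Icc.prod isCompact_Icc).prod (isCompact_Icc.prod isCompact_Icc)).image
        (continuous_tubePoint v₁ v₂)
    obtain ⟨D, hD⟩ := hcpt'.exists_bound_of_continuousOn (hG.continuousOn.mono (by
      rintro _ ⟨⟨p, y⟩, ⟨-, hy₁, hy₂⟩, rfl⟩
      simp only [mem_Icc] at hy₁ hy₂
      have a₁ := mul_pos hw.1 (sub_pos.2 hs1)
      have a₂ := mul_pos hw.2 (sub_pos.2 hs1)
      constructor <;> simp [tubePoint] <;> linarith))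
    refine ⟨D, fun t ht => ?_⟩
    obtain ⟨p, hp, hGp⟩ := exists_apply_tubePoint_eq hv h₁ h₂ (hL t (ht.trans_lt hs1))
    rw [← hGp]
    rw [abs_le] at ht
    refine hD _ ⟨_, ⟨hp, ?_, ?_⟩, rfl⟩
    · simp only [hLi₁]
      constructor <;> exact mul_le_mul_of_nonneg_left (by linarith) hw.1.le
    · simp only [hLi₂]
      constructor <;> exact mul_le_mul_of_nonneg_left (by linarith) hw.2.le
  obtain ⟨D, hD⟩ := hbdd
  have hdiff : DiffContOnCl ℂ (fun t => G (L t)) (Complex.im ⁻¹' Ioo (-s) s) := by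
    have : DifferentiableOn ℂ (fun t => G (L t)) {t | |t.im| < 1} :=
      hG.comp hLd.differentiableOn hL
    refine (this.mono ?_).diffContOnCl
    refine (closure_minimal (t := Complex.im ⁻¹' Icc (-s) s) (preimage_mono Ioo_subset_Icc_self)
      (isClosed_Icc.preimage Complex.continuous_im)).trans fun t ht => ?_
    exact (abs_le.2 ht).trans_lt hs1
  -- Boundedness on the strip gives the growth condition with both growth constants zero. The
  -- conclusion at `t = 0` concerns `L 0 = w`.
  have := PhragmenLindelof.horizontal_strip (z := 0) (C := B) hdiff
    ⟨0, div_pos Real.pi_pos (by linarith), 0, ?_⟩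
    (fun t ht => hedge t (by rw [ht]; ring)) (fun t ht => hedge t (by rw [ht]))
    (by simpa using hs0.le) (by simpa using hs0.le)
  · simpa [L] using this
  · refine Asymptotics.IsBigO.of_bound D ?_
    filter_upwards [mem_inf_of_right (mem_principal_self _)] with t ht
    simpa using hD t (abs_le.2 ⟨ht.1.le, ht.2.le⟩)

end HilbertModular

/-! ### Automorphy factors and translates of forms -/

namespace HilbertModular

open Complex Set UpperHalfPlane

variable {F : Type*} [Field F] (σ₁ σ₂ : F →+* ℝ)

/-- The automorphy factor `c z + d` of `γ` through the real embedding `σ`. -/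
noncomputable def autFactor (σ : F →+* ℝ) (γ : SL(2, F)) (z : ℍ) : ℂ :=
  (σ (γ 1 0) : ℂ) * (z : ℂ) + (σ (γ 1 1) : ℂ)

lemma autFactor_eq_denom (σ : F →+* ℝ) (γ : SL(2, F)) (z : ℍ) :
    autFactor σ γ z = denom (Matrix.SpecialLinearGroup.map σ γ : SL(2, ℝ)) z := by
  simp [autFactor, denom]

lemma autFactor_ne_zero (σ : F →+* ℝ) (γ : SL(2, F)) (z : ℍ) : autFactor σ γ z ≠ 0 := by
  rw [autFactor_eq_denom]
  exact denom_ne_zero _ z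

lemma coe_map_smul (σ : F →+* ℝ) (γ : SL(2, F)) (z : ℍ) :
    ((Matrix.SpecialLinearGroup.map σ γ • z : ℍ) : ℂ) =
      ((σ (γ 0 0) : ℂ) * z + σ (γ 0 1)) / autFactor σ γ z := by
  rw [coe_specialLinearGroup_apply]
  simp [autFactor]

lemma autFactor_mul (σ : F →+* ℝ) (g h : SL(2, F)) (z : ℍ) :
    autFactor σ (g * h) z =
      autFactor σ g (Matrix.SpecialLinearGroup.map σ h • z) * autFactor σ h z := by
  have hne := autFactor_ne_zero σ h z
  rw [autFactor, autFactor, coe_map_smul]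
  field_simp
  simp only [Matrix.SpecialLinearGroup.coe_mul, Matrix.mul_apply, Fin.sum_univ_two, map_add,
    map_mul, ofReal_add, ofReal_mul, autFactor]
  ring

lemma im_map_smul (σ : F →+* ℝ) (γ : SL(2, F)) (z : ℍ) :
    (Matrix.SpecialLinearGroup.map σ γ • z).im = z.im / ‖autFactor σ γ z‖ ^ 2 := by
  rw [autFactor_eq_denom, ← normSq_eq_norm_sq, MulAction.compHom_smul_def, im_smul_eq_div_normSq]
  simp
  rfl

lemma factor_eq (k : ℤ) (γ : SL(2, F)) (z : ℍ × ℍ) :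
    factor σ₁ σ₂ k k γ z = (autFactor σ₁ γ z.1 * autFactor σ₂ γ z.2) ^ k :=
  (mul_zpow _ _ _).symm

lemma act_mul (g h : SL(2, F)) (z : ℍ × ℍ) :
    act σ₁ σ₂ (g * h) z = act σ₁ σ₂ g (act σ₁ σ₂ h z) := by
  simp [act, mul_smul]

lemma continuous_act (g : SL(2, F)) : Continuous (act σ₁ σ₂ g) :=
  (continuous_fst.const_smul _).prodMk (continuous_snd.const_smul _)

lemma factor_mul (k : ℤ) (g h : SL(2, F)) (z : ℍ × ℍ) :
    factor σ₁ σ₂ k k (g * h) z = factor σ₁ σ₂ k k g (act σ₁ σ₂ h z) * factor σ₁ σ₂ k k h z := by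
  simp only [factor_eq, autFactor_mul, act, ← mul_zpow]
  congr 1
  ring

lemma factor_ne_zero (k : ℤ) (g : SL(2, F)) (z : ℍ × ℍ) : factor σ₁ σ₂ k k g z ≠ 0 := by
  rw [factor_eq]
  exact zpow_ne_zero _ (mul_ne_zero (autFactor_ne_zero _ _ _) (autFactor_ne_zero _ _ _))

lemma continuous_factor (k : ℤ) (g : SL(2, F)) : Continuous (factor σ₁ σ₂ k k g) := by
  simp only [funext (factor_eq σ₁ σ₂ k g)]
  refine Continuous.zpow₀ ?_ _ fun z => Or.inl
    (mul_ne_zero (autFactor_ne_zero _ _ _) (autFactor_ne_zero _ _ _))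
  unfold autFactor
  have := UpperHalfPlane.continuous_coe
  fun_prop

/-- The translate `f | α` of a function on `ℍ × ℍ` by `α ∈ SL₂(F)`. -/
noncomputable def slash (k : ℤ) (f : ℍ × ℍ → ℂ) (α : SL(2, F)) (z : ℍ × ℍ) : ℂ :=
  (factor σ₁ σ₂ k k α z)⁻¹ * f (act σ₁ σ₂ α z)

/-- The translate `f | α` is modular for `α⁻¹ Γ α`: this follows from computing the factor of `α u =
(α u α⁻¹) α` in two ways by the cocycle relation. -/
lemma slash_act {k : ℤ} {f : ℍ × ℍ → ℂ} {Γ : Subgroup SL(2, F)}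
    (hf : f ∈ modularForms σ₁ σ₂ k k Γ) {α u : SL(2, F)} (hu : α * u * α⁻¹ ∈ Γ) (z : ℍ × ℍ) :
    slash σ₁ σ₂ k f α (act σ₁ σ₂ u z) = factor σ₁ σ₂ k k u z * slash σ₁ σ₂ k f α z := by
  have h₁ : act σ₁ σ₂ α (act σ₁ σ₂ u z) = act σ₁ σ₂ (α * u * α⁻¹) (act σ₁ σ₂ α z) := by
    simp only [← act_mul, inv_mul_cancel_right]
  have h₂ := factor_mul σ₁ σ₂ k α u z
  have h₃ := factor_mul σ₁ σ₂ k (α * u * α⁻¹) α z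
  rw [inv_mul_cancel_right, h₂] at h₃
  rw [slash, slash, h₁, hf.2 _ hu]
  have n₁ := factor_ne_zero σ₁ σ₂ k α z
  have n₂ := factor_ne_zero σ₁ σ₂ k α (act σ₁ σ₂ u z)
  field_simp
  linear_combination -f (act σ₁ σ₂ α z) * h₃

lemma isHolomorphic_slash (k : ℤ) {f : ℍ × ℍ → ℂ} (hf : IsHolomorphic f) (α : SL(2, F)) :
    IsHolomorphic (slash σ₁ σ₂ k f α) := by
  have hden (σ : F →+* ℝ) (w : ℂ) (hw : 0 < w.im) :
      (σ (α 1 0) : ℂ) * w + σ (α 1 1) ≠ 0 := autFactor_ne_zero σ α ⟨w, hw⟩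
  have hmap (σ : F →+* ℝ) (w : ℂ) (hw : 0 < w.im) :
      ((Matrix.SpecialLinearGroup.map σ α • ofComplex w : ℍ) : ℂ) =
        ((σ (α 0 0) : ℂ) * w + σ (α 0 1)) / ((σ (α 1 0) : ℂ) * w + σ (α 1 1)) := by
    rw [coe_map_smul, ofComplex_apply_of_im_pos hw]
    rfl
  have hmem : ∀ w ∈ upperDomain,
      (((σ₁ (α 0 0) : ℂ) * w.1 + σ₁ (α 0 1)) / ((σ₁ (α 1 0) : ℂ) * w.1 + σ₁ (α 1 1)),
        ((σ₂ (α 0 0) : ℂ) * w.2 + σ₂ (α 0 1)) / ((σ₂ (α 1 0) : ℂ) * w.2 + σ₂ (α 1 1))) ∈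
        upperDomain := by
    intro w hw
    rw [← hmap σ₁ w.1 hw.1, ← hmap σ₂ w.2 hw.2]
    exact coePair_mem (_, _)
  have hcomp : DifferentiableOn ℂ (fun w : ℂ × ℂ =>
      ((((σ₁ (α 1 0) : ℂ) * w.1 + σ₁ (α 1 1)) * ((σ₂ (α 1 0) : ℂ) * w.2 + σ₂ (α 1 1))) ^ k)⁻¹ *
      extendPair f
        (((σ₁ (α 0 0) : ℂ) * w.1 + σ₁ (α 0 1)) / ((σ₁ (α 1 0) : ℂ) * w.1 + σ₁ (α 1 1)),
        ((σ₂ (α 0 0) : ℂ) * w.2 + σ₂ (α 0 1)) / ((σ₂ (α 1 0) : ℂ) * w.2 + σ₂ (α 1 1))))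
      upperDomain := by
    refine DifferentiableOn.mul (DifferentiableOn.inv (DifferentiableOn.zpow (by fun_prop) ?_) ?_)
      (DifferentiableOn.comp (g := extendPair f) (t := upperDomain) hf ?_ hmem)
    · exact Or.inl fun w hw => mul_ne_zero (hden σ₁ _ hw.1) (hden σ₂ _ hw.2)
    · exact fun w hw => zpow_ne_zero _ (mul_ne_zero (hden σ₁ _ hw.1) (hden σ₂ _ hw.2))
    · simp only [div_eq_mul_inv]
      refine DifferentiableOn.prodMk (DifferentiableOn.mul (by fun_prop)
        (DifferentiableOn.inv (by fun_prop) ?_)) (DifferentiableOn.mul (by fun_prop)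
        (DifferentiableOn.inv (by fun_prop) ?_))
      · exact fun w hw => hden σ₁ _ hw.1
      · exact fun w hw => hden σ₂ _ hw.2
  refine hcomp.congr fun w hw => ?_
  rw [← hmap σ₁ w.1 hw.1, ← hmap σ₂ w.2 hw.2]
  simp only [slash, factor_eq, autFactor, extendPair, ofComplex_apply, act]
  rw [ofComplex_apply_of_im_pos hw.1, ofComplex_apply_of_im_pos hw.2]

end HilbertModular

/-! ### Norms, units and integers of a real quadratic field -/

namespace HilbertModular

open NumberField

section RealEmbeddings

variable {F : Type*} [Field F] {σ₁ σ₂ : F →+* ℝ}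

lemma ofRealHom_comp_ne (hσ : σ₁ ≠ σ₂) :
    Complex.ofRealHom.comp σ₁ ≠ Complex.ofRealHom.comp σ₂ := fun h =>
  hσ (RingHom.ext fun x => Complex.ofReal_injective (RingHom.congr_fun h x))

variable [NumberField F]

lemma norm_eq_mul (hF : Module.finrank ℚ F = 2) (hσ : σ₁ ≠ σ₂) (x : F) :
    ((Algebra.norm ℚ x : ℚ) : ℝ) = σ₁ x * σ₂ x := by
  classical
  let τ₁ : F →ₐ[ℚ] ℂ := (Complex.ofRealHom.comp σ₁).toRatAlgHom
  let τ₂ : F →ₐ[ℚ] ℂ := (Complex.ofRealHom.comp σ₂).toRatAlgHom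
  have hτ : τ₁ ≠ τ₂ := fun h =>
    ofRealHom_comp_ne hσ (RingHom.ext fun y => DFunLike.congr_fun h y)
  -- A quadratic field has exactly two complex embeddings, so two distinct real ones exhaust them.
  have huniv : (Finset.univ : Finset (F →ₐ[ℚ] ℂ)) = {τ₁, τ₂} := by
    refine (Finset.eq_of_subset_of_card_le (Finset.subset_univ _) ?_).symm
    rw [Finset.card_univ, AlgHom.card ℚ F ℂ, hF, Finset.card_pair hτ]
  have h := Algebra.norm_eq_prod_embeddings ℚ ℂ x
  rw [huniv, Finset.prod_pair hτ] at h
  have h' : (((Algebra.norm ℚ x : ℚ) : ℝ) : ℂ) = ((σ₁ x * σ₂ x : ℝ) : ℂ) := by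
    push_cast
    exact h
  exact_mod_cast h'

lemma int_norm_eq_mul (hF : Module.finrank ℚ F = 2) (hσ : σ₁ ≠ σ₂) (x : 𝓞 F) :
    ((Algebra.norm ℤ x : ℤ) : ℝ) = σ₁ (x : F) * σ₂ (x : F) := by
  rw [← norm_eq_mul hF hσ, ← Algebra.coe_norm_int]
  simp

lemma one_le_abs_mul (hF : Module.finrank ℚ F = 2) (hσ : σ₁ ≠ σ₂) {x : 𝓞 F} (hx : x ≠ 0) :
    1 ≤ |σ₁ (x : F) * σ₂ (x : F)| := by
  rw [← int_norm_eq_mul hF hσ]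
  exact_mod_cast Int.one_le_abs (Algebra.norm_ne_zero_iff.2 hx)

lemma abs_mul_unit (hF : Module.finrank ℚ F = 2) (hσ : σ₁ ≠ σ₂) (u : (𝓞 F)ˣ) :
    |σ₁ ((u : 𝓞 F) : F) * σ₂ ((u : 𝓞 F) : F)| = 1 := by
  rw [← int_norm_eq_mul hF hσ]
  have := Int.isUnit_iff_abs_eq.1 (u.isUnit.map (Algebra.norm ℤ))
  exact_mod_cast this

/-- Dirichlet's unit theorem supplies a unit that is small at every place except that of `σ₂`. The
place of `σ₁` is a different one, since real embeddings are their own conjugates. -/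
lemma exists_unit_abs_lt_one (hσ : σ₁ ≠ σ₂) : ∃ u : (𝓞 F)ˣ, |σ₁ ((u : 𝓞 F) : F)| < 1 := by
  obtain ⟨u, hu⟩ := Units.dirichletUnitTheorem.exists_unit F
    (InfinitePlace.mk (Complex.ofRealHom.comp σ₂))
  refine ⟨u, ?_⟩
  have hne : InfinitePlace.mk (Complex.ofRealHom.comp σ₁) ≠
      InfinitePlace.mk (Complex.ofRealHom.comp σ₂) := by
    rw [Ne, InfinitePlace.mk_eq_iff, not_or]
    refine ⟨ofRealHom_comp_ne hσ, fun h => ofRealHom_comp_ne hσ ?_⟩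
    rw [← h]
    ext x
    simp [ComplexEmbedding.conjugate]
  have h := hu _ hne
  rw [InfinitePlace.apply] at h
  have hpos : 0 < |σ₁ ((u : 𝓞 F) : F)| := abs_pos.2 (by simp)
  rw [← Real.log_neg_iff hpos]
  simpa using h

/-- For such a `θ` the vectors `(1, 1)` and `(σ₁ θ, σ₂ θ)` are independent. The lattice they span
serves as periods at the cusps and in Minkowski's theorem; a full integral basis is not required. -/
lemma exists_integer_ne (hσ : σ₁ ≠ σ₂) : ∃ θ : 𝓞 F, σ₁ (θ : F) ≠ σ₂ (θ : F) := by
  by_contra! h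
  refine hσ (IsFractionRing.injective_comp_algebraMap (A := 𝓞 F) ?_)
  ext x
  exact h x

end RealEmbeddings

/-! ### Minkowski's theorem on linear forms -/

section Minkowski

open MeasureTheory

/-- Minkowski's theorem on linear forms. -/
theorem exists_int_vec_abs_mulVec_le {n : ℕ} (A : Matrix (Fin n) (Fin n) ℝ) (hA : A.det ≠ 0)
    {R : ℝ} (hR : 0 ≤ R) (hAR : |A.det| < R ^ n) :
    ∃ m : Fin n → ℤ, m ≠ 0 ∧ ∀ i, |A.mulVec (fun j => (m j : ℝ)) i| ≤ R := by
  -- The preimage of the cube has volume `(2R)ⁿ / |det A|`, which exceeds `2ⁿ` times the covolume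
  -- `1` of the integer lattice.
  let s : Set (Fin n → ℝ) := Matrix.toLin' A ⁻¹' (Set.univ.pi fun _ => Set.Icc (-R) R)
  have hdet : LinearMap.det (Matrix.toLin' A) ≠ 0 := by simpa using hA
  have hvol : volume s = ENNReal.ofReal (|A.det|⁻¹ * (2 * R) ^ n) := by
    rw [Measure.addHaar_preimage_linearMap _ hdet, volume_pi_pi]
    simp only [Real.volume_Icc, LinearMap.det_toLin', sub_neg_eq_add, Finset.prod_const,
      Finset.card_univ, Fintype.card_fin, abs_inv]
    rw [ENNReal.ofReal_mul (by positivity), ENNReal.ofReal_pow (by positivity), two_mul]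
  have hF : volume (ZSpan.fundamentalDomain (Pi.basisFun ℝ (Fin n))) = 1 := by
    rw [ZSpan.fundamentalDomain_pi_basisFun, volume_pi_pi]
    simp
  have : Countable (Submodule.span ℤ (Set.range (Pi.basisFun ℝ (Fin n)))).toAddSubgroup :=
    inferInstanceAs (Countable (Submodule.span ℤ (Set.range (Pi.basisFun ℝ (Fin n)))))
  have hsymm : ∀ x ∈ s, -x ∈ s := by
    intro x hx i _
    have := hx i trivial
    rw [map_neg]
    exact ⟨neg_le_neg this.2, neg_le.1 this.1⟩
  have hconv : Convex ℝ s := (convex_pi fun i _ => convex_Icc _ _).linear_preimage _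
  have hlt : volume (ZSpan.fundamentalDomain (Pi.basisFun ℝ (Fin n))) *
      2 ^ Module.finrank ℝ (Fin n → ℝ) < volume s := by
    rw [hF, hvol, one_mul, Module.finrank_fin_fun, mul_pow, mul_left_comm]
    have h2 : (2 : ENNReal) ^ n = ENNReal.ofReal (2 ^ n) := by
      rw [ENNReal.ofReal_pow two_pos.le]; simp
    rw [h2, ENNReal.ofReal_lt_ofReal_iff_of_nonneg (by positivity)]
    have : 1 < |A.det|⁻¹ * R ^ n := by
      rwa [lt_inv_mul_iff₀ (abs_pos.2 hA), mul_one]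
    exact lt_mul_of_one_lt_right (by positivity) this
  obtain ⟨x, hx0, hx⟩ := exists_ne_zero_mem_lattice_of_measure_mul_two_pow_lt_measure
    (ZSpan.isAddFundamentalDomain' (Pi.basisFun ℝ (Fin n)) volume) hsymm hconv hlt
  have hint : ∀ j, ∃ m : ℤ, (m : ℝ) = (x : Fin n → ℝ) j := fun j => by
    have := (Pi.basisFun ℝ (Fin n)).mem_span_iff_repr_mem ℤ (x : Fin n → ℝ) |>.1 x.2 j
    simpa using this
  choose m hm using hint
  refine ⟨m, ?_, fun i => ?_⟩
  · rintro rfl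
    exact hx0 (Subtype.ext (funext fun j => by simpa using (hm j).symm))
  · have := hx i trivial
    rw [Matrix.toLin'_apply, ← funext hm] at this
    exact abs_le.2 this

end Minkowski

end HilbertModular

/-! ### Commensurability and finiteness of cusps -/

namespace HilbertModular

open NumberField

variable {F : Type*} [Field F] [NumberField F]

lemma mem_fullGroup_iff {γ : SL(2, F)} :
    γ ∈ fullGroup F ↔ ∀ i j, γ i j ∈ (algebraMap (𝓞 F) F).range := by
  constructor
  · rintro ⟨g, rfl⟩ i j
    exact ⟨g i j, rfl⟩
  · intro h
    choose M hM using h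
    have hdet : (Matrix.of M).det = 1 := by
      apply FaithfulSMul.algebraMap_injective (𝓞 F) F
      have := γ.det_coe
      rw [Matrix.det_fin_two] at this ⊢
      simpa [hM] using this
    exact ⟨⟨Matrix.of M, hdet⟩, by ext i j; exact hM i j⟩

/-- A common denominator of the entries of a matrix. -/
lemma exists_denominator (α : SL(2, F)) :
    ∃ D : 𝓞 F, D ≠ 0 ∧ ∀ i j, (D : F) * α i j ∈ (algebraMap (𝓞 F) F).range := by
  obtain ⟨D, hD⟩ := IsLocalization.exist_integer_multiples_of_finite (nonZeroDivisors (𝓞 F))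
    (fun p : Fin 2 × Fin 2 => α p.1 p.2)
  refine ⟨D, nonZeroDivisors.ne_zero D.2, fun i j => ?_⟩
  obtain ⟨x, hx⟩ := hD (i, j)
  exact ⟨x, by rw [hx, Algebra.smul_def]⟩

/-- If `D` clears the denominators of `α`, and hence of `α⁻¹`, conjugation by `α` keeps matrices
congruent to `1` modulo `D²` integral. Some power of `u` is of this kind because `SL₂(𝓞_F / D²)` is
finite. -/
lemma exists_pow_conj_mem_fullGroup (α : SL(2, F)) {u : SL(2, F)} (hu : u ∈ fullGroup F) :
    ∃ n : ℕ, 0 < n ∧ α * u ^ n * α⁻¹ ∈ fullGroup F := by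
  obtain ⟨u, rfl⟩ := hu
  obtain ⟨D, hD0, hD⟩ := exists_denominator α
  have hD' : ∀ i j, (D : F) * α⁻¹ i j ∈ (algebraMap (𝓞 F) F).range := by
    intro i j
    rw [Matrix.SpecialLinearGroup.SL2_inv_expl]
    fin_cases i <;> fin_cases j
    · simpa using hD 1 1
    · simpa using neg_mem (hD 0 1)
    · simpa using neg_mem (hD 1 0)
    · simpa using hD 0 0
  have hbot : Ideal.span {D ^ 2} ≠ ⊥ := by simpa using hD0
  have := Ideal.finiteQuotientOfFreeOfNeBot _ hbot
  have : Finite SL(2, 𝓞 F ⧸ Ideal.span {D ^ 2}) := Subtype.finite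
  obtain ⟨n, hn, hpow⟩ := (isOfFinOrder_of_finite
    (Matrix.SpecialLinearGroup.map (Ideal.Quotient.mk (Ideal.span {D ^ 2})) u)).exists_pow_eq_one
  refine ⟨n, hn, ?_⟩
  rw [← map_pow] at hpow ⊢
  generalize u ^ n = v at hpow
  have hX : ∀ i j, ∃ x : 𝓞 F, v i j = (1 : Matrix (Fin 2) (Fin 2) (𝓞 F)) i j + D ^ 2 * x := by
    intro i j
    have h := congrArg (fun g : SL(2, 𝓞 F ⧸ Ideal.span {D ^ 2}) => g i j) hpow
    have h' : Ideal.Quotient.mk (Ideal.span {D ^ 2}) (v i j) =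
        Ideal.Quotient.mk (Ideal.span {D ^ 2}) ((1 : Matrix (Fin 2) (Fin 2) (𝓞 F)) i j) := by
      refine Eq.trans h ?_
      by_cases hij : i = j <;> simp [Matrix.one_apply, hij]
    rw [Ideal.Quotient.eq, Ideal.mem_span_singleton] at h'
    obtain ⟨x, hx⟩ := h'
    exact ⟨x, by rw [← hx]; ring⟩
  choose X hX using hX
  rw [mem_fullGroup_iff]
  intro i j
  have key : (α * Matrix.SpecialLinearGroup.map (algebraMap (𝓞 F) F) v * α⁻¹) i j =
      (1 : Matrix (Fin 2) (Fin 2) F) i j +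
        ∑ a, ∑ b, ((D : F) * α i a) * (X a b : F) * ((D : F) * α⁻¹ b j) := by
    have h1 : (1 : Matrix (Fin 2) (Fin 2) F) i j = (α * α⁻¹) i j := by
      rw [mul_inv_cancel]; rfl
    rw [h1]
    simp only [Matrix.SpecialLinearGroup.coe_mul, Matrix.mul_apply, Fin.sum_univ_two,
      Matrix.SpecialLinearGroup.map_apply_coe, RingHom.mapMatrix_apply, Matrix.map_apply, hX]
    simp
    ring
  rw [key]
  refine add_mem ?_ (sum_mem fun a _ => sum_mem fun b _ =>
    mul_mem (mul_mem (hD i a) ⟨_, rfl⟩) (hD' b j))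
  rw [Matrix.one_apply]
  split_ifs
  · exact one_mem _
  · exact zero_mem _

lemma exists_pow_conj_mem {Γ : Subgroup SL(2, F)} (hΓ : Γ.relIndex (fullGroup F) ≠ 0)
    (α : SL(2, F)) {u : SL(2, F)} (hu : u ∈ fullGroup F) :
    ∃ n : ℕ, 0 < n ∧ α * u ^ n * α⁻¹ ∈ Γ := by
  obtain ⟨n, hn, h⟩ := exists_pow_conj_mem_fullGroup α hu
  obtain ⟨m, hm, -, hmem⟩ := Subgroup.exists_pow_mem_of_relIndex_ne_zero hΓ h
  refine ⟨n * m, Nat.mul_pos hn hm, ?_⟩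
  rw [conj_pow, ← pow_mul] at hmem
  exact hmem.1

lemma exists_finite_leftCosets {Γ : Subgroup SL(2, F)} (hΓ : Γ.relIndex (fullGroup F) ≠ 0) :
    ∃ T : Set SL(2, F), T.Finite ∧ ∀ γ ∈ fullGroup F, ∃ β ∈ T, ∃ δ ∈ Γ ⊓ fullGroup F,
      γ = β * δ := by
  have : Finite (fullGroup F ⧸ Γ.subgroupOf (fullGroup F)) :=
    Subgroup.index_ne_zero_iff_finite.1 hΓ
  refine ⟨Set.range fun q : fullGroup F ⧸ Γ.subgroupOf (fullGroup F) => (q.out : SL(2, F)),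
    Set.finite_range _, fun γ hγ => ?_⟩
  obtain ⟨h, hh⟩ := QuotientGroup.mk_out_eq_mul (Γ.subgroupOf (fullGroup F)) ⟨γ, hγ⟩
  refine ⟨_, ⟨(⟨γ, hγ⟩ : fullGroup F), rfl⟩, ((h : fullGroup F)⁻¹ : fullGroup F),
    ⟨?_, SetLike.coe_mem _⟩, ?_⟩
  · exact Subgroup.mem_subgroupOf.1 (inv_mem h.2)
  · simp [hh]

/-- A nonzero pair of integers is the bottom row of a matrix of determinant one whose top row lies
in the inverse of the ideal generated by the pair. -/
lemma exists_row_completion {c d : 𝓞 F} (h : c ≠ 0 ∨ d ≠ 0) :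
    ∃ a b : F, a * d - b * c = 1 ∧ a * c ∈ (algebraMap (𝓞 F) F).range ∧
      a * d ∈ (algebraMap (𝓞 F) F).range ∧ b * c ∈ (algebraMap (𝓞 F) F).range ∧
      b * d ∈ (algebraMap (𝓞 F) F).range := by
  set I : Ideal (𝓞 F) := Ideal.span {c, d} with hI
  have hc : c ∈ I := Ideal.subset_span (by simp)
  have hd : d ∈ I := Ideal.subset_span (by simp)
  obtain ⟨w, hw0, hwI⟩ : ∃ w, w ≠ 0 ∧ w ∈ I := by
    rcases h with h | h
    exacts [⟨c, h, hc⟩, ⟨d, h, hd⟩]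
  -- In a Dedekind domain `I` divides `(w)`, so `J / w` is the inverse of `I`; writing `w = c j₁ + d
  -- j₂` produces the top row.
  obtain ⟨J, hJ⟩ := Ideal.dvd_span_singleton.2 hwI
  have hw : w ∈ I * J := hJ ▸ Ideal.mem_span_singleton_self w
  rw [hI, Ideal.span_insert, Ideal.sup_mul, Submodule.mem_sup] at hw
  obtain ⟨_, h₁, _, h₂, hsum⟩ := hw
  obtain ⟨j₁, hj₁, rfl⟩ := Ideal.mem_span_singleton_mul.1 h₁
  obtain ⟨j₂, hj₂, rfl⟩ := Ideal.mem_span_singleton_mul.1 h₂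
  have hwF : (w : F) ≠ 0 := by simpa using hw0
  have hint : ∀ x ∈ I, ∀ j ∈ J, (j : F) / w * x ∈ (algebraMap (𝓞 F) F).range := by
    intro x hx j hj
    have hmem : x * j ∈ Ideal.span {w} := hJ ▸ Ideal.mul_mem_mul hx hj
    obtain ⟨t, ht⟩ := Ideal.mem_span_singleton.1 hmem
    refine ⟨t, ?_⟩
    have ht' : (x : F) * j = w * t := by exact_mod_cast congrArg (algebraMap (𝓞 F) F) ht
    field_simp
    linear_combination -ht'
  refine ⟨j₂ / w, -(j₁ / w), ?_, hint c hc j₂ hj₂, hint d hd j₂ hj₂, ?_, ?_⟩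
  · have hs : (c : F) * j₁ + d * j₂ = w := by exact_mod_cast congrArg (algebraMap (𝓞 F) F) hsum
    field_simp
    linear_combination hs
  · rw [neg_mul]
    exact neg_mem (hint c hc j₁ hj₁)
  · rw [neg_mul]
    exact neg_mem (hint d hd j₁ hj₁)

/-- The two bottom rows generate the same fractional ideal. Transporting the top row of `A` along
the change of generators gives `B` of determinant one with bottom row `(c, d)`. The entries of `A⁻¹
B` are integral combinations of products of a top and a bottom entry of `A`, hence integral. -/
lemma exists_mem_fullGroup_row_eq {A : SL(2, F)}
    (hA : ∀ j l, A 0 j * A 1 l ∈ (algebraMap (𝓞 F) F).range) {c d : F}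
    (u v u' v' p q p' q' : 𝓞 F) (hu : A 1 0 = u * c + v * d) (hu' : A 1 1 = u' * c + v' * d)
    (hp : c = p * A 1 0 + q * A 1 1) (hp' : d = p' * A 1 0 + q' * A 1 1) :
    ∃ γ ∈ fullGroup F, (A * γ) 1 0 = c ∧ (A * γ) 1 1 = d := by
  have hdet : A 0 0 * A 1 1 - A 0 1 * A 1 0 = 1 := by
    rw [← Matrix.det_fin_two]; exact A.det_coe
  let a : F := A 0 0 * v' - A 0 1 * v
  let b : F := A 0 1 * u - A 0 0 * u'
  have hab : a * d - b * c = 1 := by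
    rw [← hdet]
    simp only [a, b]
    linear_combination (-A 0 0) * hu' + A 0 1 * hu
  let B : SL(2, F) := ⟨!![a, b; c, d], by rw [Matrix.det_fin_two_of, hab]⟩
  have hB : A * (A⁻¹ * B) = B := mul_inv_cancel_left A B
  refine ⟨A⁻¹ * B, ?_, by rw [hB]; rfl, by rw [hB]; rfl⟩
  rw [mem_fullGroup_iff]
  have key (x : 𝓞 F) (j l : Fin 2) : A 0 j * A 1 l * x ∈ (algebraMap (𝓞 F) F).range :=
    mul_mem (hA j l) ⟨x, rfl⟩
  have hentry (i j : Fin 2) : (A⁻¹ * B) i j = A⁻¹ i 0 * B 0 j + A⁻¹ i 1 * B 1 j := by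
    rw [Matrix.SpecialLinearGroup.coe_mul, Matrix.mul_apply, Fin.sum_univ_two]
  have i₀₀ : A⁻¹ 0 0 = A 1 1 := by rw [Matrix.SpecialLinearGroup.SL2_inv_expl]; rfl
  have i₀₁ : A⁻¹ 0 1 = -A 0 1 := by rw [Matrix.SpecialLinearGroup.SL2_inv_expl]; rfl
  have i₁₀ : A⁻¹ 1 0 = -A 1 0 := by rw [Matrix.SpecialLinearGroup.SL2_inv_expl]; rfl
  have i₁₁ : A⁻¹ 1 1 = A 0 0 := by rw [Matrix.SpecialLinearGroup.SL2_inv_expl]; rfl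
  have b₀₀ : B 0 0 = A 0 0 * v' - A 0 1 * v := rfl
  have b₀₁ : B 0 1 = A 0 1 * u - A 0 0 * u' := rfl
  have b₁₀ : B 1 0 = p * A 1 0 + q * A 1 1 := hp
  have b₁₁ : B 1 1 = p' * A 1 0 + q' * A 1 1 := hp'
  intro i j
  rw [hentry]
  fin_cases i <;> fin_cases j <;>
    simp only [Fin.zero_eta, Fin.mk_one, i₀₀, i₀₁, i₁₀, i₁₁, b₀₀, b₀₁, b₁₀, b₁₁]
  · convert! sub_mem (sub_mem (key v' 0 1) (key v 1 1)) (add_mem (key p 1 0) (key q 1 1)) using 1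
    ring
  · convert! sub_mem (sub_mem (key u 1 1) (key u' 0 1)) (add_mem (key p' 1 0) (key q' 1 1)) using 1
    ring
  · convert! add_mem (sub_mem (key v 1 0) (key v' 0 0)) (add_mem (key p 0 0) (key q 0 1)) using 1
    ring
  · convert! add_mem (sub_mem (key u' 0 0) (key u 1 0)) (add_mem (key p' 0 0) (key q' 0 1)) using 1
    ring

/-- Up to scaling by a field element of bounded norm, every nonzero pair of integers is the bottom
row of a member of one of finitely many cosets of `SL₂(𝓞_F)`: this is the finiteness of the number
of cusps. -/
theorem exists_finite_coset_row (hF : Module.finrank ℚ F = 2) {σ₁ σ₂ : F →+* ℝ} (hσ : σ₁ ≠ σ₂) :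
    ∃ S : Set SL(2, F), S.Finite ∧ ∃ C : ℝ, ∀ c d : 𝓞 F, (c ≠ 0 ∨ d ≠ 0) →
      ∃ A ∈ S, ∃ γ ∈ fullGroup F, ∃ l : F, (A * γ) 1 0 = l * c ∧ (A * γ) 1 1 = l * d ∧
        |σ₁ l * σ₂ l| ≤ C := by
  let P := {p : 𝓞 F × 𝓞 F // p.1 ≠ 0 ∨ p.2 ≠ 0}
  let I : P → Ideal (𝓞 F) := fun p => Ideal.span {p.1.1, p.1.2}
  have hI : ∀ p, I p ≠ ⊥ := fun p h => by
    rw [Ideal.span_eq_bot] at h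
    rcases p.2 with h' | h'
    exacts [h' (h _ (by simp)), h' (h _ (by simp))]
  -- One representative pair per ideal class is enough: pairs in the same class generate the same
  -- ideal after scaling by an element of `F`.
  let cls : P → ClassGroup (𝓞 F) := fun p =>
    ClassGroup.mk0 ⟨I p, mem_nonZeroDivisors_iff_ne_zero.2 (hI p)⟩
  have hA : ∀ p : P, ∃ A : SL(2, F), A 1 0 = p.1.1 ∧ A 1 1 = p.1.2 ∧
      ∀ j l, A 0 j * A 1 l ∈ (algebraMap (𝓞 F) F).range := by
    intro p
    obtain ⟨a, b, hdet, h₁, h₂, h₃, h₄⟩ := exists_row_completion p.2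
    refine ⟨⟨!![a, b; (p.1.1 : F), (p.1.2 : F)], by rw [Matrix.det_fin_two_of, hdet]⟩, rfl, rfl, ?_⟩
    intro j l
    fin_cases j <;> fin_cases l
    exacts [h₁, h₂, h₃, h₄]
  choose A hA₀ hA₁ hA using hA
  have hsec : ∀ κ : Set.range cls, ∃ q, cls q = κ := fun κ => κ.2
  choose sec hsec using hsec
  obtain ⟨C, hC⟩ := (Set.finite_range fun κ => (Ideal.absNorm (I (sec κ)) : ℝ)).bddAbove
  refine ⟨Set.range fun κ => A (sec κ), Set.finite_range _, C, fun c d hcd => ?_⟩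
  let p : P := ⟨(c, d), hcd⟩
  set q := sec ⟨cls p, p, rfl⟩ with hq
  have hpq : cls p = cls q := (hsec ⟨cls p, p, rfl⟩).symm
  obtain ⟨x, y, hx, hy, hxy⟩ := ClassGroup.mk0_eq_mk0_iff.1 hpq
  replace hxy : Ideal.span {x} * I p = Ideal.span {y} * I q := hxy
  have hxF : (x : F) ≠ 0 := by simpa using hx
  have hyF : (y : F) ≠ 0 := by simpa using hy
  have to_q : ∀ t ∈ I p, ∃ r s : 𝓞 F, (x / y : F) * t = r * q.1.1 + s * q.1.2 := by
    intro t ht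
    have : x * t ∈ Ideal.span {y} * I q :=
      hxy ▸ Ideal.mul_mem_mul (Ideal.mem_span_singleton_self x) ht
    obtain ⟨i, hi, hit⟩ := Ideal.mem_span_singleton_mul.1 this
    obtain ⟨r, s, rfl⟩ := Ideal.mem_span_pair.1 hi
    have hit' : (y : F) * (r * q.1.1 + s * q.1.2) = x * t := by
      exact_mod_cast congrArg (algebraMap (𝓞 F) F) hit
    refine ⟨r, s, ?_⟩
    field_simp
    linear_combination -hit'
  have to_p : ∀ t ∈ I q, ∃ r s : 𝓞 F, (t : F) = r * (x / y * c) + s * (x / y * d) := by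
    intro t ht
    have : y * t ∈ Ideal.span {x} * I p :=
      hxy ▸ Ideal.mul_mem_mul (Ideal.mem_span_singleton_self y) ht
    obtain ⟨i, hi, hit⟩ := Ideal.mem_span_singleton_mul.1 this
    obtain ⟨r, s, rfl⟩ := Ideal.mem_span_pair.1 hi
    have hit' : (x : F) * (r * c + s * d) = y * t := by
      exact_mod_cast congrArg (algebraMap (𝓞 F) F) hit
    refine ⟨r, s, ?_⟩
    field_simp
    linear_combination -hit'
  obtain ⟨u, v, huv⟩ := to_p q.1.1 (Ideal.subset_span (by simp))
  obtain ⟨u', v', huv'⟩ := to_p q.1.2 (Ideal.subset_span (by simp))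
  obtain ⟨r, s, hrs⟩ := to_q c (Ideal.subset_span (by simp [p]))
  obtain ⟨r', s', hrs'⟩ := to_q d (Ideal.subset_span (by simp [p]))
  obtain ⟨γ, hγ, h₀, h₁⟩ := exists_mem_fullGroup_row_eq (hA q) u v u' v' r s r' s'
    ((hA₀ q).trans huv) ((hA₁ q).trans huv') (by rw [hA₀, hA₁]; exact hrs)
    (by rw [hA₀, hA₁]; exact hrs')
  refine ⟨A q, ⟨_, rfl⟩, γ, hγ, x / y, h₀, h₁, le_trans ?_ (hC ⟨⟨cls p, p, rfl⟩, rfl⟩)⟩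
  -- Comparing norms, `|N(x / y)| = N(I q) / N(I p) ≤ N(I q)`, and only finitely many `q` occur.
  have hnorm := congrArg Ideal.absNorm hxy
  rw [map_mul, map_mul, Ideal.absNorm_span_singleton, Ideal.absNorm_span_singleton] at hnorm
  have habs (t : 𝓞 F) : (((Algebra.norm ℤ) t).natAbs : ℝ) = |σ₁ (t : F) * σ₂ (t : F)| := by
    rw [← int_norm_eq_mul hF hσ, Nat.cast_natAbs, Int.cast_abs]
  have hnorm' : |σ₁ (x : F) * σ₂ (x : F)| * Ideal.absNorm (I p) =
      |σ₁ (y : F) * σ₂ (y : F)| * Ideal.absNorm (I q) := by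
    rw [← habs, ← habs]
    exact_mod_cast hnorm
  have hp1 : (1 : ℝ) ≤ Ideal.absNorm (I p) := by
    exact_mod_cast Nat.one_le_iff_ne_zero.2 (Ideal.absNorm_eq_zero_iff.not.2 (hI p))
  have hy1 : 0 < |σ₁ (y : F) * σ₂ (y : F)| := one_pos.trans_le (one_le_abs_mul hF hσ hy)
  rw [map_div₀, map_div₀, div_mul_div_comm, abs_div, div_le_iff₀ hy1, mul_comm (_ : ℝ) |_|,
    ← hnorm']
  exact le_mul_of_one_le_right (abs_nonneg _) hp1

end HilbertModular

/-! ### Reduction theory -/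

namespace HilbertModular

open NumberField UpperHalfPlane

variable {F : Type*} [Field F] [NumberField F] {σ₁ σ₂ : F →+* ℝ}

/-- Every point `z` admits a nonzero pair of integers `(c, d)` for which the norm of `c z + d` is
small compared with the imaginary part of `z`. -/
theorem exists_row_norm_le (hσ : σ₁ ≠ σ₂) :
    ∃ C : ℝ, 0 ≤ C ∧ ∀ z : ℍ × ℍ, ∃ c d : 𝓞 F, (c ≠ 0 ∨ d ≠ 0) ∧
      (‖(σ₁ c : ℂ) * z.1 + σ₁ d‖ * ‖(σ₂ c : ℂ) * z.2 + σ₂ d‖) ^ 2 ≤ C * (z.1.im * z.2.im) := by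
  obtain ⟨θ, hθ⟩ := exists_integer_ne hσ
  set t₁ := σ₁ (θ : F)
  set t₂ := σ₂ (θ : F)
  set R := |t₂ - t₁| + 1 with hR
  have hR1 : 1 ≤ R := le_add_of_nonneg_left (abs_nonneg _)
  refine ⟨4 * R ^ 4, by positivity, fun z => ?_⟩
  have hy₁ := z.1.im_pos
  have hy₂ := z.2.im_pos
  set s₁ := √z.1.im with hs₁
  set s₂ := √z.2.im with hs₂
  have hs₁0 : 0 < s₁ := Real.sqrt_pos.2 hy₁
  have hs₂0 : 0 < s₂ := Real.sqrt_pos.2 hy₂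
  have hsq₁ : z.1.im = s₁ ^ 2 := (Real.sq_sqrt hy₁.le).symm
  have hsq₂ : z.2.im = s₂ ^ 2 := (Real.sq_sqrt hy₂.le).symm
  -- With `c = m₀ + m₁ θ` and `d = m₂ + m₃ θ`, the four forms are the imaginary and real parts of `c
  -- z + d` at both embeddings, divided by `√(Im z)`. This normalisation makes the determinant
  -- independent of `z`.
  let A : Matrix (Fin 4) (Fin 4) ℝ :=
    !![s₁, t₁ * s₁, 0, 0;
      s₂, t₂ * s₂, 0, 0;
      z.1.re / s₁, t₁ * z.1.re / s₁, 1 / s₁, t₁ / s₁;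
      z.2.re / s₂, t₂ * z.2.re / s₂, 1 / s₂, t₂ / s₂]
  have hdet : A.det = (t₂ - t₁) ^ 2 := by
    simp [A, Matrix.det_succ_row_zero, Fin.sum_univ_succ, Fin.succAbove]
    field_simp
    ring
  have hA0 : A.det ≠ 0 := by
    rw [hdet]
    exact pow_ne_zero 2 (sub_ne_zero.2 hθ.symm)
  have hAR : |A.det| < R ^ 4 := by
    rw [hdet, abs_pow]
    have h1 : |t₂ - t₁| ^ 2 < R ^ 2 := by
      gcongr
      rw [hR]
      linarith
    nlinarith [one_le_pow₀ hR1 (n := 2)]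
  obtain ⟨m, hm0, hm⟩ := exists_int_vec_abs_mulVec_le A hA0 (by positivity) hAR
  refine ⟨m 0 + m 1 * θ, m 2 + m 3 * θ, ?_, ?_⟩
  · by_contra! hcd
    have hzero : ∀ a b : ℤ, (a + b * θ : 𝓞 F) = 0 → a = 0 ∧ b = 0 := by
      intro a b h
      have h' : (a + b * θ : F) = 0 := by
        simpa using congrArg (algebraMap (𝓞 F) F) h
      have h₁ : (a + b * t₁ : ℝ) = 0 := by simpa using congrArg σ₁ h'
      have h₂ : (a + b * t₂ : ℝ) = 0 := by simpa using congrArg σ₂ h'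
      have hb : (b : ℝ) = 0 := by
        have : (b : ℝ) * (t₁ - t₂) = 0 := by linear_combination h₁ - h₂
        exact (mul_eq_zero.1 this).resolve_right (sub_ne_zero.2 hθ)
      rw [hb, zero_mul, add_zero] at h₁
      exact ⟨by exact_mod_cast h₁, by exact_mod_cast hb⟩
    obtain ⟨h0, h1⟩ := hzero _ _ hcd.1
    obtain ⟨h2, h3⟩ := hzero _ _ hcd.2
    refine hm0 (funext fun i => ?_)
    fin_cases i
    exacts [h0, h1, h2, h3]
  · have hbound : ∀ (w : ℍ) (t s : ℝ), 0 < s → w.im = s ^ 2 →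
        |(m 0 : ℝ) * s + m 1 * (t * s)| ≤ R →
        |(m 0 : ℝ) * (w.re / s) + m 1 * (t * w.re / s) + m 2 * (1 / s) + m 3 * (t / s)| ≤ R →
        ‖((m 0 + m 1 * t : ℝ) : ℂ) * w + ((m 2 + m 3 * t : ℝ) : ℂ)‖ ^ 2 ≤ 2 * R ^ 2 * w.im := by
      intro w t s hs hw h₁ h₂
      rw [← Complex.normSq_eq_norm_sq, Complex.normSq_apply]
      simp only [Complex.add_re, Complex.add_im, Complex.re_ofReal_mul, Complex.im_ofReal_mul,
        Complex.ofReal_re, Complex.ofReal_im, coe_re, coe_im, add_zero]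
      have e₁ : (m 0 + m 1 * t) * w.im = ((m 0 : ℝ) * s + m 1 * (t * s)) * s := by
        rw [hw]; ring
      have e₂ : (m 0 + m 1 * t) * w.re + (m 2 + m 3 * t) =
          ((m 0 : ℝ) * (w.re / s) + m 1 * (t * w.re / s) + m 2 * (1 / s) + m 3 * (t / s)) * s := by
        field_simp
        ring
      have q₁ := sq_le_sq' (abs_le.1 h₁).1 (abs_le.1 h₁).2
      have q₂ := sq_le_sq' (abs_le.1 h₂).1 (abs_le.1 h₂).2
      rw [e₁, e₂, hw]
      nlinarith [mul_le_mul_of_nonneg_right q₁ (sq_nonneg s),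
        mul_le_mul_of_nonneg_right q₂ (sq_nonneg s)]
    have b₁ := hbound z.1 t₁ s₁ hs₁0 hsq₁
      (by simpa [A, Matrix.mulVec, dotProduct, Fin.sum_univ_succ, mul_comm] using hm 0)
      (by simpa [A, Matrix.mulVec, dotProduct, Fin.sum_univ_succ, mul_comm, add_assoc] using hm 2)
    have b₂ := hbound z.2 t₂ s₂ hs₂0 hsq₂
      (by simpa [A, Matrix.mulVec, dotProduct, Fin.sum_univ_succ, mul_comm] using hm 1)
      (by simpa [A, Matrix.mulVec, dotProduct, Fin.sum_univ_succ, mul_comm, add_assoc] using hm 3)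
    have c₁ : σ₁ ((m 0 + m 1 * θ : 𝓞 F) : F) = m 0 + m 1 * t₁ := by simp [t₁]
    have c₂ : σ₂ ((m 0 + m 1 * θ : 𝓞 F) : F) = m 0 + m 1 * t₂ := by simp [t₂]
    have d₁ : σ₁ ((m 2 + m 3 * θ : 𝓞 F) : F) = m 2 + m 3 * t₁ := by simp [t₁]
    have d₂ : σ₂ ((m 2 + m 3 * θ : 𝓞 F) : F) = m 2 + m 3 * t₂ := by simp [t₂]
    rw [c₁, c₂, d₁, d₂, mul_pow]
    calc _ ≤ (2 * R ^ 2 * z.1.im) * (2 * R ^ 2 * z.2.im) :=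
          mul_le_mul b₁ b₂ (by positivity) (by positivity)
      _ = _ := by ring

/-- Reduction theory: every point of `ℍ × ℍ` is carried by `Γ`, followed by one of finitely many
elements of `SL₂(F)`, to a point whose imaginary part has norm bounded below. -/
theorem exists_finite_reduction (hF : Module.finrank ℚ F = 2) (hσ : σ₁ ≠ σ₂)
    {Γ : Subgroup SL(2, F)} (hΓ : Γ.relIndex (fullGroup F) ≠ 0) :
    ∃ S : Set SL(2, F), S.Finite ∧ ∃ c : ℝ, 0 < c ∧ ∀ z : ℍ × ℍ,
      ∃ α ∈ S, ∃ δ ∈ Γ ⊓ fullGroup F,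
        c ≤ (act σ₁ σ₂ (α * δ) z).1.im * (act σ₁ σ₂ (α * δ) z).2.im := by
  obtain ⟨S, hS, C, hC⟩ := exists_finite_coset_row hF hσ
  obtain ⟨T, hT, hTΓ⟩ := exists_finite_leftCosets hΓ
  obtain ⟨C', hC'0, hC'⟩ := exists_row_norm_le hσ
  refine ⟨Set.image2 (· * ·) S T, hS.image2 _ hT, (C ^ 2 * C' + 1)⁻¹, by positivity, fun z => ?_⟩
  obtain ⟨c, d, hcd, hle⟩ := hC' z
  obtain ⟨A, hA, γ, hγ, l, h₀, h₁, hl⟩ := hC c d hcd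
  obtain ⟨β, hβ, δ, hδ, rfl⟩ := hTΓ γ hγ
  refine ⟨A * β, ⟨A, hA, β, hβ, rfl⟩, δ, hδ, ?_⟩
  rw [← mul_assoc] at h₀ h₁
  have hj (σ : F →+* ℝ) (w : ℍ) :
      ‖autFactor σ (A * β * δ) w‖ = |σ l| * ‖(σ c : ℂ) * w + σ d‖ := by
    rw [autFactor, h₀, h₁, ← Real.norm_eq_abs, ← Complex.norm_real, ← norm_mul]
    congr 1
    push_cast [map_mul]
    ring
  have hne (σ : F →+* ℝ) (w : ℍ) := norm_pos_iff.2 (autFactor_ne_zero σ (A * β * δ) w)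
  have hy := mul_pos z.1.im_pos z.2.im_pos
  -- As `Im (γ w) = Im w / |j(γ, w)|²`, a bottom row with small `|c z + d|` makes the norm of the
  -- imaginary part large.
  simp only [act, im_map_smul]
  rw [div_mul_div_comm, ← mul_pow, inv_eq_one_div, div_le_div_iff₀ (by positivity)
    (pow_pos (mul_pos (hne _ _) (hne _ _)) 2), hj, hj]
  have hl2 : (|σ₁ l| * |σ₂ l|) ^ 2 ≤ C ^ 2 := by
    rw [← abs_mul]
    gcongr
  calc _ = (|σ₁ l| * |σ₂ l|) ^ 2 *
        (‖(σ₁ c : ℂ) * z.1 + σ₁ d‖ * ‖(σ₂ c : ℂ) * z.2 + σ₂ d‖) ^ 2 := by ring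
    _ ≤ C ^ 2 * (C' * (z.1.im * z.2.im)) := mul_le_mul hl2 hle (by positivity) (by positivity)
    _ ≤ _ := by nlinarith

/-- The automorphy factor is bounded below on a coset of `SL₂(𝓞_F)`. -/
theorem exists_le_norm_autFactor (hF : Module.finrank ℚ F = 2) (hσ : σ₁ ≠ σ₂) (α : SL(2, F)) :
    ∃ m : ℝ, 0 < m ∧ ∀ δ ∈ fullGroup F, ∀ z : ℍ × ℍ, m * min 1 (z.1.im * z.2.im) ≤
      ‖autFactor σ₁ (α * δ) z.1 * autFactor σ₂ (α * δ) z.2‖ := by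
  obtain ⟨D, hD0, hD⟩ := exists_denominator α
  have hN := one_pos.trans_le (one_le_abs_mul hF hσ hD0)
  refine ⟨|σ₁ (D : F) * σ₂ (D : F)|⁻¹, inv_pos.2 hN, fun δ hδ z => ?_⟩
  -- Entries of `α δ` become integers after multiplication by `D`, so the nonzero ones have norm at
  -- least `1 / |N(D)|`.
  have hent : ∀ i j, (α * δ) i j ≠ 0 →
      |σ₁ (D : F) * σ₂ (D : F)|⁻¹ ≤ |σ₁ ((α * δ) i j) * σ₂ ((α * δ) i j)| := by
    intro i j hne
    have hmem : (D : F) * (α * δ) i j ∈ (algebraMap (𝓞 F) F).range := by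
      rw [Matrix.SpecialLinearGroup.coe_mul, Matrix.mul_apply, Finset.mul_sum]
      refine sum_mem fun a _ => ?_
      rw [← mul_assoc]
      exact mul_mem (hD i a) (mem_fullGroup_iff.1 hδ a j)
    obtain ⟨x, hx⟩ := hmem
    have hx0 : x ≠ 0 := by
      rintro rfl
      rw [map_zero, eq_comm, mul_eq_zero] at hx
      exact hx.elim (by simpa using hD0) hne
    have := one_le_abs_mul hF hσ hx0
    replace hx : (x : F) = D * (α * δ) i j := hx
    rw [hx, map_mul, map_mul, mul_mul_mul_comm, abs_mul] at this
    rwa [inv_le_iff_one_le_mul₀' hN]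
  rw [norm_mul]
  have hy := mul_pos z.1.im_pos z.2.im_pos
  by_cases hc : (α * δ) 1 0 = 0
  · have hd : (α * δ) 1 1 ≠ 0 := by
      intro hd
      have := (α * δ).det_coe
      rw [Matrix.det_fin_two, hc, hd] at this
      simp at this
    have hj (σ : F →+* ℝ) (w : ℍ) : ‖autFactor σ (α * δ) w‖ = |σ ((α * δ) 1 1)| := by
      rw [autFactor, hc]
      simp
    rw [hj, hj, ← abs_mul]
    exact (mul_le_of_le_one_right (inv_pos.2 hN).le (min_le_left _ _)).trans (hent 1 1 hd)
  · have hj (σ : F →+* ℝ) (w : ℍ) : |σ ((α * δ) 1 0)| * w.im ≤ ‖autFactor σ (α * δ) w‖ := by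
      refine le_trans (le_of_eq ?_) (Complex.abs_im_le_norm _)
      simp [autFactor, abs_mul, abs_of_pos w.im_pos]
    calc _ ≤ |σ₁ ((α * δ) 1 0) * σ₂ ((α * δ) 1 0)| * (z.1.im * z.2.im) :=
          mul_le_mul (hent 1 0 hc) (min_le_right _ _) (le_min zero_le_one hy.le) (abs_nonneg _)
      _ = (|σ₁ ((α * δ) 1 0)| * z.1.im) * (|σ₂ ((α * δ) 1 0)| * z.2.im) := by
          rw [abs_mul]; ring
      _ ≤ _ := mul_le_mul (hj _ _) (hj _ _) (by positivity) (norm_nonneg _)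

end HilbertModular

/-! ### Bounds at the cusps -/

namespace HilbertModular

open NumberField UpperHalfPlane

section Cusp

variable {F : Type*} [Field F]

/-- The unipotent matrix `(1 ν; 0 1)`. -/
def unipotent (ν : F) : SL(2, F) := ⟨!![1, ν; 0, 1], by simp [Matrix.det_fin_two_of]⟩

lemma coe_unipotent (ν : F) : (unipotent ν : Matrix (Fin 2) (Fin 2) F) = !![1, ν; 0, 1] := rfl

lemma unipotent_pow (ν : F) (n : ℕ) : unipotent ν ^ n = unipotent (n * ν) := by
  induction n with
  | zero =>
    ext i j
    fin_cases i <;> fin_cases j <;> simp [coe_unipotent]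
  | succ n ih =>
    rw [pow_succ, ih]
    ext i j
    fin_cases i <;> fin_cases j <;> simp [coe_unipotent]
    ring

/-- The diagonal matrix `(ε 0; 0 ε⁻¹)`. -/
def torus (ε : Fˣ) : SL(2, F) := ⟨!![(ε : F), 0; 0, (ε⁻¹ : Fˣ)], by simp [Matrix.det_fin_two_of]⟩

lemma coe_torus (ε : Fˣ) :
    (torus ε : Matrix (Fin 2) (Fin 2) F) = !![(ε : F), 0; 0, (ε⁻¹ : Fˣ)] := rfl

lemma torus_pow (ε : Fˣ) (n : ℕ) : torus ε ^ n = torus (ε ^ n) := by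
  induction n with
  | zero =>
    ext i j
    fin_cases i <;> fin_cases j <;> simp [coe_torus]
  | succ n ih =>
    rw [pow_succ, ih]
    ext i j
    fin_cases i <;> fin_cases j <;> simp [coe_torus, pow_succ, mul_comm]

variable (σ₁ σ₂ : F →+* ℝ)

lemma coePair_act_unipotent (ν : F) (z : ℍ × ℍ) :
    coePair (act σ₁ σ₂ (unipotent ν) z) =
      ((coePair z).1 + (σ₁ ν : ℂ), (coePair z).2 + (σ₂ ν : ℂ)) := by
  simp [coePair, act, coe_map_smul, autFactor, coe_unipotent]

lemma factor_unipotent (k : ℤ) (ν : F) (z : ℍ × ℍ) : factor σ₁ σ₂ k k (unipotent ν) z = 1 := by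
  simp [factor, coe_unipotent]

lemma coePair_act_torus (ε : Fˣ) (z : ℍ × ℍ) :
    coePair (act σ₁ σ₂ (torus ε) z) =
      (((σ₁ ε ^ 2 : ℝ) : ℂ) * (coePair z).1, ((σ₂ ε ^ 2 : ℝ) : ℂ) * (coePair z).2) := by
  simp [coePair, act, coe_map_smul, autFactor, coe_torus]
  constructor <;> ring

lemma norm_factor_torus (k : ℤ) (ε : Fˣ) (hε : |σ₁ ε * σ₂ ε| = 1) (z : ℍ × ℍ) :
    ‖factor σ₁ σ₂ k k (torus ε) z‖ = 1 := by
  have : factor σ₁ σ₂ k k (torus ε) z = (((σ₁ ε * σ₂ ε : ℝ) : ℂ)⁻¹) ^ k := by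
    rw [factor_eq]
    congr 1
    simp [autFactor, coe_torus, mul_comm]
  rw [this, norm_zpow, norm_inv, Complex.norm_real, Real.norm_eq_abs, hε]
  simp

variable {σ₁ σ₂} [NumberField F]

lemma unipotent_mem_fullGroup (ν : 𝓞 F) : unipotent (ν : F) ∈ fullGroup F := by
  rw [mem_fullGroup_iff]
  intro i j
  fin_cases i <;> fin_cases j
  exacts [one_mem _, ⟨ν, rfl⟩, zero_mem _, one_mem _]

lemma torus_mem_fullGroup (ε : (𝓞 F)ˣ) :
    torus (Units.map (algebraMap (𝓞 F) F : 𝓞 F →* F) ε) ∈ fullGroup F := by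
  rw [mem_fullGroup_iff]
  intro i j
  fin_cases i <;> fin_cases j
  exacts [⟨ε, rfl⟩, zero_mem _, zero_mem _, ⟨(ε⁻¹ : (𝓞 F)ˣ), rfl⟩]

/-- The Koecher principle in quantitative form: near a cusp, a Hilbert modular form is bounded by
its size on a compact set. -/
theorem exists_isCompact_slash_bound (hF : Module.finrank ℚ F = 2) (hσ : σ₁ ≠ σ₂)
    {Γ : Subgroup SL(2, F)} (hΓ : Γ.relIndex (fullGroup F) ≠ 0) (k : ℤ) (α : SL(2, F))
    {c : ℝ} (hc : 0 < c) :
    ∃ K : Set (ℍ × ℍ), IsCompact K ∧ ∀ f ∈ modularForms σ₁ σ₂ k k Γ, ∀ B : ℝ,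
      (∀ w ∈ K, ‖slash σ₁ σ₂ k f α w‖ ≤ B) →
      ∀ z : ℍ × ℍ, c ≤ z.1.im * z.2.im → ‖slash σ₁ σ₂ k f α z‖ ≤ B := by
  obtain ⟨θ, hθ⟩ := exists_integer_ne hσ
  obtain ⟨ε, hε⟩ := exists_unit_abs_lt_one hσ
  obtain ⟨n₁, hn₁, hu₁⟩ := exists_pow_conj_mem hΓ α (unipotent_mem_fullGroup (1 : 𝓞 F))
  obtain ⟨n₂, hn₂, hu₂⟩ := exists_pow_conj_mem hΓ α (unipotent_mem_fullGroup θ)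
  obtain ⟨n₃, hn₃, hu₃⟩ := exists_pow_conj_mem hΓ α (torus_mem_fullGroup ε)
  rw [unipotent_pow] at hu₁ hu₂
  rw [torus_pow] at hu₃
  set ν₁ : F := n₁ * ((1 : 𝓞 F) : F) with hν₁
  set ν₂ : F := n₂ * (θ : F) with hν₂
  set η : Fˣ := (Units.map (algebraMap (𝓞 F) F : 𝓞 F →* F) ε) ^ n₃ with hη
  have hη₁ : (η : F) = ((ε : 𝓞 F) : F) ^ n₃ := rfl
  have hηabs : |σ₁ η * σ₂ η| = 1 := by
    rw [hη₁, map_pow, map_pow, ← mul_pow, abs_pow, abs_mul_unit hF hσ, one_pow]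
  have hv : (σ₁ ν₁, σ₂ ν₁).1 * (σ₁ ν₂, σ₂ ν₂).2 - (σ₁ ν₁, σ₂ ν₁).2 * (σ₁ ν₂, σ₂ ν₂).1 ≠ 0 := by
    have : (σ₁ ν₁, σ₂ ν₁).1 * (σ₁ ν₂, σ₂ ν₂).2 - (σ₁ ν₁, σ₂ ν₁).2 * (σ₁ ν₂, σ₂ ν₂).1 =
        n₁ * n₂ * (σ₂ (θ : F) - σ₁ (θ : F)) := by
      simp [hν₁, hν₂]
      ring
    rw [this]
    have hn₁' : (n₁ : ℝ) ≠ 0 := by exact_mod_cast hn₁.ne'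
    have hn₂' : (n₂ : ℝ) ≠ 0 := by exact_mod_cast hn₂.ne'
    exact mul_ne_zero (mul_ne_zero hn₁' hn₂') (sub_ne_zero.2 hθ.symm)
  have he0 : 0 < σ₁ η ^ 2 := by
    have : σ₁ η ≠ 0 := by simp
    positivity
  have he1 : σ₁ η ^ 2 < 1 := by
    rw [hη₁, map_pow, ← sq_abs, abs_pow, ← pow_mul]
    exact pow_lt_one₀ (abs_nonneg _) hε (by omega)
  -- A unit has norm `±1`, so its torus element scales the coordinates by `e` and `e⁻¹`. For
  -- parallel weight its automorphy factor is a power of that norm, hence of absolute value one.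
  have heinv : σ₂ η ^ 2 = (σ₁ η ^ 2)⁻¹ := by
    rw [eq_comm]
    refine inv_eq_of_mul_eq_one_right ?_
    rw [← mul_pow, ← sq_abs, hηabs, one_pow]
  obtain ⟨K, hKU, hK, hbound⟩ := exists_isCompact_bound_of_periodic hv he0 he1 hc
  refine ⟨coePair ⁻¹' K, isCompact_preimage_coePair hK hKU, fun f hf B hB z hz => ?_⟩
  set h := slash σ₁ σ₂ k f α with hh
  have hper : ∀ ν : F, α * unipotent ν * α⁻¹ ∈ Γ → ∀ w ∈ upperDomain,
      extendPair h (w.1 + (σ₁ ν : ℂ), w.2 + (σ₂ ν : ℂ)) = extendPair h w := by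
    intro ν hν w hw
    rw [← range_coePair] at hw
    obtain ⟨w, rfl⟩ := hw
    rw [← coePair_act_unipotent, extendPair_coePair, extendPair_coePair, hh, slash_act σ₁ σ₂ hf hν,
      factor_unipotent, one_mul]
  have hlift : ∀ w ∈ K, ‖extendPair h w‖ ≤ B := by
    intro w hw
    obtain ⟨w', rfl⟩ : w ∈ Set.range coePair := range_coePair ▸ hKU hw
    rw [extendPair_coePair]
    exact hB w' hw
  rw [← extendPair_coePair h z]
  refine hbound (extendPair h) (isHolomorphic_slash σ₁ σ₂ k hf.1 α) (hper ν₁ hu₁) (hper ν₂ hu₂)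
    (fun w hw => ?_) B hlift (coePair z) (coePair_mem z) hz
  rw [← range_coePair] at hw
  obtain ⟨w, rfl⟩ := hw
  rw [← heinv, ← coePair_act_torus, extendPair_coePair, extendPair_coePair, hh,
    slash_act σ₁ σ₂ hf hu₃, norm_mul, norm_factor_torus σ₁ σ₂ k η hηabs, one_mul]

end Cusp

/-- Bounds for the inverse automorphy factor at the points of a compact set which are moved close
to the cusp at infinity. -/
lemma exists_norm_factor_inv_le {F : Type*} [Field F] [NumberField F] {σ₁ σ₂ : F →+* ℝ}
    (hF : Module.finrank ℚ F = 2) (hσ : σ₁ ≠ σ₂) (k : ℤ) (α : SL(2, F)) {c : ℝ} (hc : 0 < c)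
    {Q : Set (ℍ × ℍ)} (hQ : IsCompact Q) :
    ∃ E : ℝ, ∀ δ ∈ fullGroup F, ∀ z ∈ Q,
      c ≤ (act σ₁ σ₂ (α * δ) z).1.im * (act σ₁ σ₂ (α * δ) z).2.im →
      ‖(factor σ₁ σ₂ k k (α * δ) z)⁻¹‖ ≤ E := by
  rcases Q.eq_empty_or_nonempty with rfl | hne
  · exact ⟨0, by simp⟩
  obtain ⟨m, hm, hle⟩ := exists_le_norm_autFactor hF hσ α
  have hcont : Continuous fun z : ℍ × ℍ => z.1.im * z.2.im :=
    (UpperHalfPlane.continuous_im.comp continuous_fst).mul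
      (UpperHalfPlane.continuous_im.comp continuous_snd)
  obtain ⟨p, -, hp⟩ := hQ.exists_isMinOn hne hcont.continuousOn
  obtain ⟨q, -, hq⟩ := hQ.exists_isMaxOn hne hcont.continuousOn
  have hp0 := mul_pos p.1.im_pos p.2.im_pos
  set a := m * min 1 (p.1.im * p.2.im) with ha
  have ha0 : 0 < a := mul_pos hm (lt_min one_pos hp0)
  -- The absolute value `N` of the weight-one factor stays in this interval for all `δ`: integrality
  -- gives the lower end, and `N² ≤ Im z₁ Im z₂ / c` the upper one. Two-sided control handles either
  -- sign of `k`.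
  have hzpow : ContinuousOn (fun x : ℝ => (x ^ k)⁻¹) (Set.Icc a √(q.1.im * q.2.im / c)) := by
    intro x hx
    have hx0 : x ≠ 0 := (ha0.trans_le hx.1).ne'
    exact ((continuousAt_zpow₀ x k (Or.inl hx0)).inv₀ (zpow_ne_zero k hx0)).continuousWithinAt
  obtain ⟨E, hE⟩ := isCompact_Icc.exists_bound_of_continuousOn hzpow
  refine ⟨E, fun δ hδ z hz hcz => ?_⟩
  set N := ‖autFactor σ₁ (α * δ) z.1 * autFactor σ₂ (α * δ) z.2‖ with hN
  have hN0 : 0 < N :=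
    norm_pos_iff.2 (mul_ne_zero (autFactor_ne_zero _ _ _) (autFactor_ne_zero _ _ _))
  have hlow : a ≤ N := by
    refine le_trans ?_ (hle δ hδ z)
    have : p.1.im * p.2.im ≤ z.1.im * z.2.im := hp hz
    rw [ha]
    gcongr
  have hup : N ≤ √(q.1.im * q.2.im / c) := by
    refine Real.le_sqrt_of_sq_le ?_
    simp only [act, im_map_smul] at hcz
    rw [div_mul_div_comm, ← mul_pow, ← norm_mul, ← hN, le_div_iff₀ (by positivity)] at hcz
    rw [le_div_iff₀ hc, mul_comm]
    exact hcz.trans (hq hz)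
  have := hE N ⟨hlow, hup⟩
  rw [factor_eq, norm_inv, norm_zpow, ← hN]
  rwa [Real.norm_of_nonneg (by positivity)] at this

end HilbertModular

/-! ### Assembly -/

open HilbertModular in
theorem mainTheorem4 {F : Type*} [Field F] [NumberField F]
    (hF : Module.finrank ℚ F = 2) (σ₁ σ₂ : F →+* ℝ) (hσ : σ₁ ≠ σ₂)
    (Γ : Subgroup SL(2, F)) (hΓ : Subgroup.Commensurable Γ (HilbertModular.fullGroup F))
    (k : ℤ) :
    FiniteDimensional ℂ (HilbertModular.modularForms σ₁ σ₂ k k Γ) := by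
  obtain ⟨S, hS, c, hc, hred⟩ := exists_finite_reduction hF hσ hΓ.1
  choose K hK hbound using fun α : SL(2, F) => exists_isCompact_slash_bound hF hσ hΓ.1 k α⁻¹ hc
  have hfac : ∀ α : SL(2, F), ∃ E : ℝ, ∀ w ∈ K α, ‖(factor σ₁ σ₂ k k α⁻¹ w)⁻¹‖ ≤ E := fun α =>
    (hK α).exists_bound_of_continuousOn
      ((continuous_factor σ₁ σ₂ k α⁻¹).inv₀ (factor_ne_zero σ₁ σ₂ k α⁻¹)).continuousOn
  choose E hE using hfac
  refine finiteDimensional_of_forall_isCompact_bound _ (fun f hf => hf.1)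
    -- The controlling compact set collects the compact sets of the finitely many cusps, each moved
    -- back by `α⁻¹`.
    (hS.isCompact_biUnion fun α _ => (hK α).image (continuous_act σ₁ σ₂ α⁻¹)) fun Q hQ => ?_
  choose E' hE' using fun α : SL(2, F) => exists_norm_factor_inv_le hF hσ k α hc hQ
  obtain ⟨C, hC⟩ := (hS.image fun α => |E' α| * |E α|).bddAbove
  refine ⟨C, fun f hf B hB0 hB z hz => ?_⟩
  obtain ⟨α, hα, δ, hδ, hcz⟩ := hred z
  -- Since `δ ∈ Γ` and `δ = α⁻¹ (α δ)`, the cocycle relation expresses `f z` through `f | α⁻¹` at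
  -- the reduced point `α δ z`, where the cusp bound applies.
  have hslash : slash σ₁ σ₂ k f α⁻¹ (act σ₁ σ₂ (α * δ) z) = factor σ₁ σ₂ k k (α * δ) z * f z := by
    have h₁ := factor_mul σ₁ σ₂ k α⁻¹ (α * δ) z
    have h₂ := factor_ne_zero σ₁ σ₂ k α⁻¹ (act σ₁ σ₂ (α * δ) z)
    rw [inv_mul_cancel_left] at h₁
    rw [slash, ← act_mul, inv_mul_cancel_left, hf.2 δ hδ.1, h₁]
    field_simp
  have hcusp : ‖slash σ₁ σ₂ k f α⁻¹ (act σ₁ σ₂ (α * δ) z)‖ ≤ |E α| * B := by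
    refine hbound α f hf _ (fun w hw => ?_) _ hcz
    rw [slash, norm_mul]
    exact mul_le_mul ((hE α w hw).trans (le_abs_self _))
      (hB _ (Set.mem_biUnion hα ⟨w, hw, rfl⟩)) (norm_nonneg _) (abs_nonneg _)
  calc ‖f z‖ = ‖(factor σ₁ σ₂ k k (α * δ) z)⁻¹‖ *
        ‖slash σ₁ σ₂ k f α⁻¹ (act σ₁ σ₂ (α * δ) z)‖ := by
        rw [← norm_mul, hslash, inv_mul_cancel_left₀ (factor_ne_zero σ₁ σ₂ k _ z)]
    _ ≤ |E' α| * (|E α| * B) :=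
        mul_le_mul ((hE' α δ hδ.2 z hz hcz).trans (le_abs_self _)) hcusp (norm_nonneg _)
          (abs_nonneg _)
    _ = |E' α| * |E α| * B := by ring
    _ ≤ C * B := mul_le_mul_of_nonneg_right (hC ⟨α, hα, rfl⟩) hB0
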